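/- Let $\mathbb E^{1,2}$ be Minkowski space, i.e. $\mathbb R^3$ with the quadratic form $-t^2+x^2+y^2$, oriented and time-oriented, and let $\mathrm{Isom}_0$ be the group of its affine isometries that preserve the orientation and the time orientation. An almost everywhere (a.e.) $\mathbb E^{1,2}$-structure on a space $M$ is an $(\mathrm{Isom}_0,\mathbb E^{1,2})$-structure on an open subset of $M$ which is dense and locally connected in $M$ (a subset $\mathcal W\subset\mathcal U$ is locally connected in $\mathcal U$ if every connected open $\mathcal V\subset\mathcal U$ has connected intersection $\mathcal V\cap\mathcal W$). The regular locus $\mathrm{Reg}(M)$ is the largest open set to which the structure extends, and $\mathrm{Sing}(M)=M\setminus\mathrm{Reg}(M)$. An $\mathbb E^{1,2}$-morphism defined on an open set of regular points is a map with regular values which in charts is locally the restriction of elements of $\mathrm{Isom}_0$. An a.e. $\mathbb E^{1,2}$-morphism $M\to N$ is a continuous map that restricts to an $\mathbb E^{1,2}$-morphism $\mathcal W\to\mathcal V$ for some open $\mathcal W\subset \mathrm{Reg}(M)$, $\mathcal V\subset\mathrm{Reg}(N)$ that are dense and locally connected in $M$, $N$ respectively. For $\alpha\ge 0$ let $\mathbb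 E^{1,2}_\alpha$ be $\mathbb R^3$ with the a.e. $\mathbb E^{1,2}$-structure defined on $\{r>0\}$ by the flat Lorentzian metric $-dt^2+dr^2+\left(\frac{\alpha}{2\pi}r\right)^2d\theta^2$ if $\alpha>0$, and $-2\,d\tau\,dr+dr^2+r^2d\theta^2$ if $\alpha=0$, where $(t,r,\theta)$, resp. $(\tau,r,\theta)$, are the cylindrical coordinates of $\mathbb R^3$, with the standard orientation and with $t$, resp. $\tau$, increasing to the future (its charts are the local isometries to $\mathbb E^{1,2}$ preserving orientation and time orientation). Let $\mathrm{Isom}(\mathbb E^{1,2}_\alpha)$ be the set of rotations-translations $(t,r,\theta)\mapsto(t+t_0,r,\theta+\theta_0)$, $t_0,\theta_0\in\mathbb R$. Let $M$ be a topological space with an a.e. $\mathbb E^{1,2}$-structure. An $\mathbb E^{1,2}_\alpha$-chart of $M$ is a homeomorphism from an open subset of $M$ onto an open subset of $\mathbb E^{1,2}_\alpha$ which is an a.e. $\mathbb E^{1,2}$-morphism; a point of $M$ is of type $\alpha$ if it lies in the domain of an $\mathbb E^{1,2}_\alpha$-chart. An $\mathbb E^{1,2}_{\ge0}$-manifold is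 a second countable Hausdorff space with an a.e. $\mathbb E^{1,2}$-structure, every singular point of which is of type $\alpha$ for some $\alpha\ge0$. For such $M$ let $\mathrm{Sing}_\alpha(M)$ be the set of singular points of type $\alpha$. Then the following hold. (1) Let $\alpha,\beta\ge0$ with $\alpha\ne2\pi$, let $\mathcal U\subset\mathbb E^{1,2}_\alpha$ be open and connected and contain a singular point, and let $\phi:\mathrm{Reg}(\mathcal U)=\mathcal U\cap \mathrm{Reg}(\mathbb E^{1,2}_\alpha)\to\mathbb E^{1,2}_\beta$ be an $\mathbb E^{1,2}$-morphism. If $\phi$ is injective, then $\alpha=\beta$ and $\phi$ is the restriction of an element of $\mathrm{Isom}(\mathbb E^{1,2}_\alpha)$. (2) Let $\alpha,\beta,\mathcal U$ be as in (1) and let $\phi:\mathcal U\to\mathbb E^{1,2}_\beta$ be an a.e. $\mathbb E^{1,2}$-morphism. If $\phi$ is a local homeomorphism, then $\alpha=\beta$ and $\phi$ is the restriction of an element of $\mathrm{Isom}(\mathbb E^{1,2}_\alpha)$. (3) Let $M$ be an $\mathbb E^{1,2}_{\ge0}$-manifold. Every singular point of $M$ is of type $\alpha$ for exactly one $\alpha\ge0$.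 (4) Every $\mathbb E^{1,2}_{\ge0}$-manifold $M$ has a smooth $3$-manifold structure for which all $\mathbb E^{1,2}_\alpha$-charts, $\alpha\ge0$, are smooth charts (with respect to the standard smooth structure of $\mathbb R^3$). For this structure, $\mathrm{Sing}(M)$ is a closed embedded $1$-submanifold, and so is $\mathrm{Sing}_\alpha(M)$ for every $\alpha\ge0$ (the empty set being allowed). -/

import Mathlib

open Set Filter Topology
open scoped ContDiff Manifold

universe u

namespace FlatSing

noncomputable section

/-- The underlying space `ℝ³`. Coordinate `0` is the time coordinate. -/
abbrev E3 : Type := EuclideanSpace ℝ (Fin 3)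

/-! ## Minkowski space `𝔼^{1,2}` and the group `Isom₀(𝔼^{1,2})` -/

/-- The quadratic form `T(t,x,y) = -t² + x² + y²` of Minkowski space. -/
def minkForm (v : E3) : ℝ := -(v 0) ^ 2 + (v 1) ^ 2 + (v 2) ^ 2

/-- The affine isometries of Minkowski space preserving the orientation and the time orientation,
i.e. the identity component of the group of affine isometries. -/
def minkIsom : Set (E3 ≃ᵃ[ℝ] E3) :=
  {g | (∀ v, minkForm (g.linear v) = minkForm v) ∧
    0 < LinearMap.det (g.linear : E3 →ₗ[ℝ] E3) ∧
    ∀ v, minkForm v < 0 → 0 < v 0 → 0 < (g.linear v) 0}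

/-! ## Almost everywhere `𝔼^{1,2}`-structures -/

section Structures

variable {M N : Type*} [TopologicalSpace M] [TopologicalSpace N]

/-- Two charts with values in Minkowski space are compatible if the change of chart is locally
the restriction of elements of `Isom₀(𝔼^{1,2})`. -/
def Compatible (e e' : OpenPartialHomeomorph M E3) : Prop :=
  ∀ x ∈ e.source ∩ e'.source, ∃ g ∈ minkIsom, ∀ᶠ y in 𝓝 x, e' y = g (e y)

/-- For `W ⊆ U`, `W` is locally connected in `U`: every connected open `V ⊆ U` has connected
intersection with `W`. -/
def LocallyConnectedIn (W U : Set M) : Prop :=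
  ∀ V ⊆ U, IsOpen V → IsConnected V → IsConnected (V ∩ W)

/-- The atlas `A` defines an almost everywhere `𝔼^{1,2}`-structure on `M`: its charts are pairwise
compatible and cover an open subset which is dense and locally connected in `M`. -/
structure IsAEStructure (A : Set (OpenPartialHomeomorph M E3)) : Prop where
  compatible : ∀ e ∈ A, ∀ e' ∈ A, Compatible e e'
  dense : Dense (⋃ e ∈ A, e.source)
  locallyConnected : LocallyConnectedIn (⋃ e ∈ A, e.source) univ

/-- All charts of `M` which are compatible with `A`. The sources are arbitrary open subsets of `M`,
not only subsets of the domain of the given atlas: this is the atlas of the maximal extension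
of the structure inside `M`. -/
def regAtlas (A : Set (OpenPartialHomeomorph M E3)) : Set (OpenPartialHomeomorph M E3) :=
  {e | ∀ e' ∈ A, Compatible e e'}

/-- The regular locus: the largest open subset to which the structure extends. -/
def Reg (A : Set (OpenPartialHomeomorph M E3)) : Set M := ⋃ e ∈ regAtlas A, e.source

/-- The singular locus. -/
def Sing (A : Set (OpenPartialHomeomorph M E3)) : Set M := (Reg A)ᶜ

/-- `f` is an `𝔼^{1,2}`-morphism near `x`: `x` and `f x` are regular and, read in charts, `f`
coincides near `x` with an element of `Isom₀(𝔼^{1,2})`. -/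
def IsMorphismAt (A : Set (OpenPartialHomeomorph M E3)) (B : Set (OpenPartialHomeomorph N E3))
    (f : M → N) (x : M) : Prop :=
  ∃ e ∈ regAtlas A, ∃ e' ∈ regAtlas B, x ∈ e.source ∧
    ∃ g ∈ minkIsom, ∀ᶠ y in 𝓝 x, f y ∈ e'.source ∧ e' (f y) = g (e y)

/-- `f` is an `𝔼^{1,2}`-morphism on the open set `W` of regular points. -/
def IsMorphismOn (A : Set (OpenPartialHomeomorph M E3)) (B : Set (OpenPartialHomeomorph N E3))
    (f : M → N) (W : Set M) : Prop :=
  ∀ x ∈ W, IsMorphismAt A B f x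

/-- `f` is an almost everywhere `𝔼^{1,2}`-morphism from the open subset `U` of `M` to `N`. -/
def IsAEMorphismOn (A : Set (OpenPartialHomeomorph M E3)) (B : Set (OpenPartialHomeomorph N E3))
    (f : M → N) (U : Set M) : Prop :=
  ContinuousOn f U ∧
  ∃ W : Set M, ∃ V : Set N,
    (IsOpen W ∧ W ⊆ U ∩ Reg A ∧ U ⊆ closure W ∧ LocallyConnectedIn W U) ∧
    (IsOpen V ∧ V ⊆ Reg B ∧ Dense V ∧ LocallyConnectedIn V univ) ∧
    MapsTo f W V ∧ IsMorphismOn A B f W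

end Structures

/-! ## The model spaces `𝔼^{1,2}_α` -/

/-- The radius of the cylindrical coordinates
`(t, r, θ) ↦ (t, r cos θ, r sin θ)` of `ℝ³` (with `τ` in place of `t` when `α = 0`). -/
def radius (p : E3) : ℝ := √((p 1) ^ 2 + (p 2) ^ 2)

/-- The differential form `dr` at `p`, off the axis. -/
def dr (p v : E3) : ℝ := (p 1 * v 1 + p 2 * v 2) / radius p

/-- The differential form `r dθ` at `p`, off the axis. -/
def rdθ (p v : E3) : ℝ := (p 1 * v 2 - p 2 * v 1) / radius p

/-- The metric of `𝔼^{1,2}_α`: `-dt² + dr² + (α/2π)² r² dθ²` if `α ≠ 0`, and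
`-2 dτ dr + dr² + r² dθ²` if `α = 0`, at a point `p` off the axis. -/
def modelMetric (α : ℝ) (p v : E3) : ℝ :=
  if α = 0 then -2 * v 0 * dr p v + (dr p v) ^ 2 + (rdθ p v) ^ 2
  else -(v 0) ^ 2 + (dr p v) ^ 2 + (α / (2 * Real.pi)) ^ 2 * (rdθ p v) ^ 2

/-- The `𝔼^{1,2}`-structure of `𝔼^{1,2}_α`, whose underlying space is `ℝ³`: its charts are the
smooth local isometries from the complement of the axis, with its metric, to Minkowski space which
preserve the orientation and the time orientation (the future being the direction of
increasing `t`, or `τ`). -/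
def modelAtlas (α : ℝ) : Set (OpenPartialHomeomorph E3 E3) :=
  {e | (∀ p ∈ e.source, 0 < radius p) ∧ ContDiffOn ℝ ∞ e e.source ∧
    ∀ p ∈ e.source,
      (∀ v, minkForm (fderiv ℝ e p v) = modelMetric α p v) ∧
      0 < (fderiv ℝ e p).det ∧
      ∀ v, modelMetric α p v < 0 → 0 < v 0 → 0 < (fderiv ℝ e p v) 0}

/-- The rotation-translation around and along the axis,
`(t, r, θ) ↦ (t + t₀, r, θ + θ₀)` in cylindrical coordinates. -/
def rotTrans (t₀ θ₀ : ℝ) (p : E3) : E3 :=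
  !₂[p 0 + t₀, Real.cos θ₀ * p 1 - Real.sin θ₀ * p 2, Real.sin θ₀ * p 1 + Real.cos θ₀ * p 2]

/-- `Isom(𝔼^{1,2}_α)`, the rotations-translations (as a set of maps of `ℝ³`, the same for all
`α`). -/
def modelIsom : Set (E3 → E3) := {ψ | ∃ t₀ θ₀ : ℝ, ψ = rotTrans t₀ θ₀}

/-! ## Singular manifolds with singularities of type `α ≥ 0` -/

section Types

variable {M : Type*} [TopologicalSpace M]

/-- `f` is a chart of `M` modelled on `𝔼^{1,2}_α`: a homeomorphism from an open subset of `M` to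
an open subset of `𝔼^{1,2}_α` which is an a.e. morphism. -/
def IsModelChart (A : Set (OpenPartialHomeomorph M E3)) (α : ℝ)
    (f : OpenPartialHomeomorph M E3) : Prop :=
  IsAEMorphismOn A (modelAtlas α) f f.source

/-- The point `p` is of type `α`. -/
def HasType (A : Set (OpenPartialHomeomorph M E3)) (α : ℝ) (p : M) : Prop :=
  ∃ f : OpenPartialHomeomorph M E3, p ∈ f.source ∧ IsModelChart A α f

/-- The singular points of type `α`. -/
def SingOfType (A : Set (OpenPartialHomeomorph M E3)) (α : ℝ) : Set M :=
  {p | p ∈ Sing A ∧ HasType A α p}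

/-- `(M, A)` is an `𝔼^{1,2}_{≥0}`-manifold: a second countable Hausdorff space with an almost
everywhere `𝔼^{1,2}`-structure, every singular point of which has a type `α ≥ 0`. -/
structure IsSingularFlatManifold (A : Set (OpenPartialHomeomorph M E3)) : Prop where
  t2 : T2Space M
  secondCountable : SecondCountableTopology M
  aeStructure : IsAEStructure A
  exists_type : ∀ p ∈ Sing A, ∃ α : ℝ, 0 ≤ α ∧ HasType A α p

/-- `S` is a closed (embedded, smooth) `1`-submanifold of the smooth `3`-manifold `M`: it is closed
and cut out, near each of its points, by the vanishing of the last two coordinates of some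
smooth chart. -/
def IsClosedOneSubmanifold [ChartedSpace E3 M] (S : Set M) : Prop :=
  IsClosed S ∧ ∀ p ∈ S, ∃ e ∈ IsManifold.maximalAtlas (𝓡 3) ∞ M, p ∈ e.source ∧
    ∀ q ∈ e.source, q ∈ S ↔ (e q) 1 = 0 ∧ (e q) 2 = 0

end Types

end

end FlatSing

/-!
The proof classifies the morphisms `φ` which are defined and injective on a punctured neighbourhood
of a point of the axis of `𝔼^{1,2}_α`, `α ≠ 2π`.

In the cylindrical coordinates `(t, r, θ)`, the space `𝔼^{1,2}_α` has an explicit developing map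
`dev α`, which changes under `θ ↦ θ + s` by a linear isometry `hol α s`: a rotation for `α > 0` and
a parabolic isometry for `α = 0`. Liouville's theorem (`exists_minkIsom_of_fderiv`) says that the
charts of `𝔼^{1,2}_α` are, up to `Isom₀`, local branches of `dev α`. As an affine map is determined
by its germ, the element of `Isom₀` by which two such branches differ is constant along connected
sets (`exists_minkIsom_eventuallyEq`).

A chart around a point of the axis would make `dev α` periodic in `θ`, so that `α = 2πm` with
`m ≥ 2`, and `dev α` is a branched covering of degree `m`; this contradicts injectivity
(`not_injOn_of_eventuallyEq_dev`). Hence the regular locus of `𝔼^{1,2}_α` is the complement of the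
axis, unless `α = 2π`.

In the remaining case `φ` has values off the axis of `𝔼^{1,2}_β`. On a solid cylinder
`{|t - t₀| < ε, 0 < r < ε}`, which is convex in cylindrical coordinates, it lifts to a map `Λ` with
`dev β ∘ Λ = g ∘ dev α` for some `g ∈ Isom₀` (`exists_isLift`), and `g` intertwines the holonomy of
`α` with a power of the one of `β`. Rotations and parabolic isometries being non-conjugate, `α` and
`β` are both positive or both zero, unless the rotation by `α` is trivial; in this case, as well as
when `g` does not preserve the axis, `φ` factors through a branched covering. Otherwise `g`
preserves the axis, `Λ` is affine in `θ` with a coefficient which must be an integer, and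
injectivity leaves only the coefficient `1`. For `α = β = 0` the boosts along the null axis have to
be excluded in this way. Unique continuation (`IsMorphismOn.eqOn_of_eventuallyEq`) spreads the
conclusion over connected open sets, whose intersections with the complement of the axis are
connected.

For almost everywhere morphisms which are open embeddings, source and target points are
simultaneously regular (`IsAEMorphismOn.mem_Reg_iff`), which reduces local homeomorphisms to the
previous case. Changes of model charts are such morphisms: near singular points they are
rotations-translations of one and the same `𝔼^{1,2}_α`, near regular points they are compositions of
smooth charts. So the type of a singular point is unique, all model charts together form a smooth
atlas, and in each model chart around a singular point the singular locus is the axis.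
-/

namespace FlatSing

/-! ### The group `Isom₀(𝔼^{1,2})` -/

lemma refl_mem_minkIsom : AffineEquiv.refl ℝ E3 ∈ minkIsom := by
  refine ⟨fun v => rfl, ?_, fun v _ h => h⟩
  have : ((AffineEquiv.refl ℝ E3).linear : E3 →ₗ[ℝ] E3) = LinearMap.id := rfl
  rw [this, LinearMap.det_id]
  exact one_pos

lemma trans_mem_minkIsom {g h : E3 ≃ᵃ[ℝ] E3} (hg : g ∈ minkIsom) (hh : h ∈ minkIsom) :
    g.trans h ∈ minkIsom := by
  refine ⟨fun v => (hh.1 _).trans (hg.1 v), ?_,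
    fun v hv h0 => hh.2.2 _ ((hg.1 v).trans_lt hv) (hg.2.2 v hv h0)⟩
  have : ((g.trans h).linear : E3 →ₗ[ℝ] E3) =
    (h.linear : E3 →ₗ[ℝ] E3) ∘ₗ (g.linear : E3 →ₗ[ℝ] E3) := rfl
  rw [this, LinearMap.det_comp]
  exact mul_pos hh.2.1 hg.2.1

lemma minkForm_neg (v : E3) : minkForm (-v) = minkForm v := by simp [minkForm]

lemma minkForm_nonneg_of_zero {v : E3} (h : v 0 = 0) : 0 ≤ minkForm v := by
  simp only [minkForm, h]; positivity

lemma symm_mem_minkIsom {g : E3 ≃ᵃ[ℝ] E3} (hg : g ∈ minkIsom) : g.symm ∈ minkIsom := by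
  have hf : ∀ v, minkForm (g.linear.symm v) = minkForm v := fun v => by
    rw [← hg.1, LinearEquiv.apply_symm_apply]
  refine ⟨hf, ?_, fun v hv h0 => ?_⟩
  · have h1 : ((g.symm).linear : E3 →ₗ[ℝ] E3) ∘ₗ (g.linear : E3 →ₗ[ℝ] E3) = LinearMap.id := by
      ext v : 1; exact g.linear.symm_apply_apply v
    have h2 := congrArg LinearMap.det h1
    rw [LinearMap.det_comp, LinearMap.det_id] at h2
    exact pos_of_mul_pos_left (h2 ▸ one_pos) hg.2.1.le
  · change 0 < (g.linear.symm v) 0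
    by_contra! hneg
    rcases hneg.lt_or_eq with hlt | heq
    · have := hg.2.2 (-(g.linear.symm v)) (by rw [minkForm_neg, hf]; exact hv) (by simpa using hlt)
      simp only [map_neg, LinearEquiv.apply_symm_apply, PiLp.neg_apply] at this
      linarith
    · have := minkForm_nonneg_of_zero heq
      rw [hf] at this
      linarith

lemma continuous_affineEquiv (g : E3 ≃ᵃ[ℝ] E3) : Continuous g :=
  (g : E3 →ᵃ[ℝ] E3).continuous_of_finiteDimensional

lemma contDiff_affineEquiv (g : E3 ≃ᵃ[ℝ] E3) : ContDiff ℝ ∞ g :=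
  ContinuousAffineMap.contDiff (⟨(g : E3 →ᵃ[ℝ] E3), continuous_affineEquiv g⟩ : E3 →ᴬ[ℝ] E3)

/-- Rigidity: an affine map is determined by its germ at a point. -/
lemma affineMap_eq_of_eventuallyEq {g h : E3 →ᵃ[ℝ] E3} {x : E3} (H : ∀ᶠ y in 𝓝 x, g y = h y) :
    g = h := by
  obtain ⟨s, hs, ho, hx⟩ := eventually_nhds_iff.1 H
  have := AffineMap.eqOn_affineSpan (k := ℝ) (f := g) (g := h) (s := s) (fun y hy => hs y hy)
  rw [ho.affineSpan_eq_top ⟨x, hx⟩] at this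
  ext1 y
  exact this (by trivial)

lemma affineEquiv_eq_of_eventuallyEq {g h : E3 ≃ᵃ[ℝ] E3} {x : E3} (H : ∀ᶠ y in 𝓝 x, g y = h y) :
    g = h :=
  AffineEquiv.toAffineMap_injective
    (affineMap_eq_of_eventuallyEq (g := (g : E3 →ᵃ[ℝ] E3)) (h := (h : E3 →ᵃ[ℝ] E3)) H)

/-! ### Analytic continuation -/

/-- Analytic continuation along a preconnected set: a map which is locally of the form `g ∘ k`
with `g ∈ Isom₀` and `k` open is of this form with a single `g`, by rigidity. -/
lemma exists_minkIsom_eventuallyEq {X : Type*} [TopologicalSpace X] {S : Set X}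
    (hS : IsPreconnected S) (hne : S.Nonempty) {f k : X → E3}
    (hk : ∀ x ∈ S, 𝓝 (k x) ≤ map k (𝓝 x))
    (h : ∀ x ∈ S, ∃ g ∈ minkIsom, ∀ᶠ y in 𝓝 x, f y = g (k y)) :
    ∃ g ∈ minkIsom, ∀ x ∈ S, ∀ᶠ y in 𝓝 x, f y = g (k y) := by
  obtain ⟨x₀, hx₀⟩ := hne
  obtain ⟨g₀, hg₀, h₀⟩ := h x₀ hx₀
  refine ⟨g₀, hg₀, ?_⟩
  let u : Set X := {x | ∀ᶠ y in 𝓝 x, f y = g₀ (k y)}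
  let v : Set X := {x | ∃ g : E3 ≃ᵃ[ℝ] E3, g ≠ g₀ ∧ ∀ᶠ y in 𝓝 x, f y = g (k y)}
  have hu : IsOpen u := isOpen_iff_mem_nhds.2 fun x hx => eventually_eventually_nhds.2 hx
  have hv : IsOpen v := isOpen_iff_mem_nhds.2 fun x ⟨g, hg, hx⟩ =>
    (eventually_eventually_nhds.2 hx).mono fun y hy => ⟨g, hg, hy⟩
  have hsub : S ⊆ u ∪ v := fun x hx => by
    obtain ⟨g, _, hgx⟩ := h x hx
    by_cases hgg : g = g₀
    · left; rw [hgg] at hgx; exact hgx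
    · right; exact ⟨g, hgg, hgx⟩
  have hdisj : S ∩ (u ∩ v) = ∅ := by
    ext x
    simp only [mem_inter_iff, mem_empty_iff_false, iff_false]
    rintro ⟨hxS, hxu, g, hgg, hgx⟩
    refine hgg (affineEquiv_eq_of_eventuallyEq (x := k x) (hk x hxS (eventually_map.2 ?_)))
    filter_upwards [hxu, hgx] with y h1 h2
    exact h2.symm.trans h1
  by_contra hcon
  obtain ⟨x, hxS, hx⟩ : ∃ x ∈ S, x ∉ u := by
    by_contra! h
    exact hcon h
  have hxv : x ∈ v := (hsub hxS).resolve_left hx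
  have := hS u v hu hv hsub ⟨x₀, hx₀, h₀⟩ ⟨x, hxS, hxv⟩
  rw [hdisj] at this
  exact this.ne_empty rfl

/-- Continuation across a nowhere dense set: on a set `V` in which `S` is dense and preconnected. -/
lemma exists_minkIsom_eqOn_of_dense {X : Type*} [TopologicalSpace X] {S V : Set X}
    (hS : IsPreconnected S) (hne : S.Nonempty) (hSV : S ⊆ V) (hVS : V ⊆ closure S) {f k : X → E3}
    (hf : ContinuousOn f V) (hkc : ContinuousOn k V)
    (hk : ∀ x ∈ S, 𝓝 (k x) ≤ map k (𝓝 x))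
    (h : ∀ x ∈ S, ∃ g ∈ minkIsom, ∀ᶠ y in 𝓝 x, f y = g (k y)) :
    ∃ g ∈ minkIsom, ∀ x ∈ V, f x = g (k x) := by
  obtain ⟨g, hg, H⟩ := exists_minkIsom_eventuallyEq hS hne hk h
  have : EqOn f (fun x => g (k x)) S := fun x hx => (H x hx).self_of_nhds
  exact ⟨g, hg, this.of_subset_closure hf ((continuous_affineEquiv g).comp_continuousOn hkc)
    hSV hVS⟩

/-! ### Maximal atlases and regular loci -/

section Structures

variable {M N K : Type*} [TopologicalSpace M] [TopologicalSpace N] [TopologicalSpace K]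
variable {A : Set (OpenPartialHomeomorph M E3)} {B : Set (OpenPartialHomeomorph N E3)}
  {C : Set (OpenPartialHomeomorph K E3)}

lemma exists_isConnected_nhd (e : OpenPartialHomeomorph M E3) {x : M} (hx : x ∈ e.source)
    {O : Set M} (hO : O ∈ 𝓝 x) :
    ∃ V, V ⊆ O ∩ e.source ∧ IsOpen V ∧ IsConnected V ∧ x ∈ V := by
  have h1 : O ∩ e.source ∈ 𝓝 x := inter_mem hO (e.open_source.mem_nhds hx)
  have h2 : e.symm ⁻¹' (O ∩ e.source) ∈ 𝓝 (e x) := by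
    have := (e.tendsto_symm hx)
    exact this h1
  obtain ⟨ε, hε, hb⟩ := Metric.mem_nhds_iff.1 (inter_mem h2 (e.open_target.mem_nhds (e.map_source hx)))
  have hbt : Metric.ball (e x) ε ⊆ e.target := fun y hy => (hb hy).2
  refine ⟨e.symm '' Metric.ball (e x) ε, ?_, ?_, ?_, ?_⟩
  · rintro _ ⟨y, hy, rfl⟩
    exact (hb hy).1
  · exact e.symm.isOpen_image_of_subset_source Metric.isOpen_ball hbt
  · have : IsConnected (Metric.ball (e x) ε) :=
      ((convex_ball _ _).isPathConnected ⟨_, Metric.mem_ball_self hε⟩).isConnected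
    exact this.image _ (e.continuousOn_symm.mono hbt)
  · exact ⟨e x, Metric.mem_ball_self hε, e.left_inv hx⟩

lemma Compatible.symm {e e' : OpenPartialHomeomorph M E3} (h : Compatible e e') :
    Compatible e' e := fun x hx => by
  obtain ⟨g, hg, H⟩ := h x ⟨hx.2, hx.1⟩
  refine ⟨g.symm, symm_mem_minkIsom hg, H.mono fun y hy => ?_⟩
  rw [hy, AffineEquiv.symm_apply_apply]

lemma isOpen_Reg : IsOpen (Reg A) := isOpen_biUnion fun e _ => e.open_source

lemma mem_Reg {x : M} : x ∈ Reg A ↔ ∃ e ∈ regAtlas A, x ∈ e.source := by simp [Reg]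

lemma IsAEStructure.subset_regAtlas (hA : IsAEStructure A) : A ⊆ regAtlas A :=
  fun e he e' he' => hA.compatible e he e' he'

/-- The charts of the maximal atlas are pairwise compatible: this is where local connectedness of
the domain of the structure is needed. -/
lemma IsAEStructure.compatible_regAtlas (hA : IsAEStructure A) {e e' : OpenPartialHomeomorph M E3}
    (he : e ∈ regAtlas A) (he' : e' ∈ regAtlas A) : Compatible e e' := by
  intro x hx
  obtain ⟨V, hV, hVo, hVc, hxV⟩ := exists_isConnected_nhd e hx.1 (e'.open_source.mem_nhds hx.2)
  have hc := hA.locallyConnected V (subset_univ _) hVo hVc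
  obtain ⟨g, hg, H⟩ := exists_minkIsom_eqOn_of_dense hc.isPreconnected hc.nonempty
    inter_subset_left (fun y hy => hA.dense.open_subset_closure_inter hVo hy)
    (e'.continuousOn.mono fun y hy => (hV hy).1) (e.continuousOn.mono fun y hy => (hV hy).2)
    (fun y hy => (e.map_nhds_eq (hV hy.1).2).ge) (by
      rintro y ⟨hyV, hy⟩
      simp only [mem_iUnion] at hy
      obtain ⟨a, ha, hya⟩ := hy
      obtain ⟨g, hg, h⟩ := he a ha y ⟨(hV hyV).2, hya⟩
      obtain ⟨g', hg', h'⟩ := he' a ha y ⟨(hV hyV).1, hya⟩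
      refine ⟨g.trans g'.symm, trans_mem_minkIsom hg (symm_mem_minkIsom hg'), ?_⟩
      filter_upwards [h, h'] with z h1 h2
      rw [AffineEquiv.trans_apply, ← h1, h2, AffineEquiv.symm_apply_apply])
  exact ⟨g, hg, Filter.mem_of_superset (hVo.mem_nhds hxV) H⟩

/-- The regular locus is dense and locally connected, since it contains the domain of the atlas. -/
lemma IsAEStructure.dense_Reg (hA : IsAEStructure A) : Dense (Reg A) :=
  hA.dense.mono (biUnion_subset_biUnion_left hA.subset_regAtlas)

lemma IsAEStructure.locallyConnectedIn_Reg (hA : IsAEStructure A) :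
    LocallyConnectedIn (Reg A) univ := fun V hVU hV hVc => by
  have h := hA.locallyConnected V hVU hV hVc
  refine h.subset_closure (inter_subset_inter_right _
    (biUnion_subset_biUnion_left hA.subset_regAtlas)) ?_
  exact inter_subset_left.trans (hA.dense.open_subset_closure_inter hV)

/-! ### Morphisms -/

lemma IsMorphismAt.mem_Reg {f : M → N} {x : M} (h : IsMorphismAt A B f x) :
    x ∈ Reg A ∧ f x ∈ Reg B := by
  obtain ⟨e, he, e', he', hx, g, hg, H⟩ := h
  exact ⟨FlatSing.mem_Reg.2 ⟨e, he, hx⟩, FlatSing.mem_Reg.2 ⟨e', he', H.self_of_nhds.1⟩⟩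

/-- A morphism is represented by an element of `Isom₀` in any pair of charts. -/
lemma IsMorphismAt.exists_eq (hA : IsAEStructure A) (hB : IsAEStructure B) {f : M → N} {x : M}
    (h : IsMorphismAt A B f x) (hfc : ContinuousAt f x)
    {e : OpenPartialHomeomorph M E3} (he : e ∈ regAtlas A) (hx : x ∈ e.source)
    {e' : OpenPartialHomeomorph N E3} (he' : e' ∈ regAtlas B) (hx' : f x ∈ e'.source) :
    ∃ g ∈ minkIsom, ∀ᶠ y in 𝓝 x, f y ∈ e'.source ∧ e' (f y) = g (e y) := by
  obtain ⟨e₁, he₁, e₁', he₁', hx₁, g, hg, H⟩ := h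
  obtain ⟨k, hk, h1⟩ := hA.compatible_regAtlas he he₁ x ⟨hx, hx₁⟩
  obtain ⟨k', hk', h2⟩ := hB.compatible_regAtlas he₁' he' (f x) ⟨H.self_of_nhds.1, hx'⟩
  refine ⟨(k.trans g).trans k', trans_mem_minkIsom (trans_mem_minkIsom hk hg) hk', ?_⟩
  filter_upwards [H, h1, hfc.eventually h2, hfc.eventually (e'.open_source.mem_nhds hx')]
    with y h3 h4 h5 h6
  refine ⟨h6, ?_⟩
  rw [h5, h3.2, h4]; rfl

lemma IsMorphismAt.continuousAt {f : M → N} {x : M} (h : IsMorphismAt A B f x) :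
    ContinuousAt f x := by
  obtain ⟨e, he, e', he', hx, g, hg, H⟩ := h
  have h1 : ContinuousAt (fun y => e'.symm (g (e y))) x := by
    have h2 : ContinuousAt e'.symm (g (e x)) := by
      rw [← H.self_of_nhds.2]
      exact e'.symm.continuousAt (e'.map_source H.self_of_nhds.1)
    exact ContinuousAt.comp (f := fun y => g (e y)) h2
      ((continuous_affineEquiv g).continuousAt.comp (e.continuousAt hx))
  refine h1.congr (H.mono fun y hy => ?_)
  change e'.symm (g (e y)) = f y
  rw [← hy.2, e'.left_inv hy.1]

lemma IsMorphismAt.congr {f f' : M → N} {x : M} (h : IsMorphismAt A B f x) (hff : f =ᶠ[𝓝 x] f') :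
    IsMorphismAt A B f' x := by
  obtain ⟨e, he, e', he', hx, g, hg, H⟩ := h
  refine ⟨e, he, e', he', hx, g, hg, ?_⟩
  filter_upwards [H, hff] with y h1 h2
  rwa [← h2]

lemma IsMorphismAt.comp (hB : IsAEStructure B) {f : M → N} {f' : N → K} {x : M}
    (h' : IsMorphismAt B C f' (f x)) (h : IsMorphismAt A B f x) :
    IsMorphismAt A C (f' ∘ f) x := by
  have hc := h.continuousAt
  obtain ⟨e, he, e₁, he₁, hx, g, hg, H⟩ := h
  obtain ⟨e₂, he₂, e', he', hx', g', hg', H'⟩ := h'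
  obtain ⟨k, hk, h1⟩ := hB.compatible_regAtlas he₁ he₂ (f x) ⟨H.self_of_nhds.1, hx'⟩
  refine ⟨e, he, e', he', hx, (g.trans k).trans g',
    trans_mem_minkIsom (trans_mem_minkIsom hg hk) hg', ?_⟩
  filter_upwards [H, hc.eventually H', hc.eventually h1] with y h3 h4 h5
  refine ⟨h4.1, ?_⟩
  rw [Function.comp_apply, h4.2, h5, h3.2]; rfl

lemma IsMorphismAt.symm {f : OpenPartialHomeomorph M N} {x : M} (hx : x ∈ f.source)
    (h : IsMorphismAt A B f x) : IsMorphismAt B A f.symm (f x) := by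
  obtain ⟨e, he, e', he', hxe, g, hg, H⟩ := h
  refine ⟨e', he', e, he, H.self_of_nhds.1, g.symm, symm_mem_minkIsom hg, ?_⟩
  have ht := f.tendsto_symm hx
  filter_upwards [ht.eventually H, ht.eventually (e.open_source.mem_nhds hxe),
    f.open_target.mem_nhds (f.map_source hx)] with y h1 h2 h3
  refine ⟨h2, ?_⟩
  rw [f.right_inv h3] at h1
  rw [h1.2, AffineEquiv.symm_apply_apply]

/-- A continuous map which is a morphism on a dense, locally connected open set is a morphism
wherever source and target are regular. -/
lemma IsAEMorphismOn.isMorphismAt (hA : IsAEStructure A) (hB : IsAEStructure B) {f : M → N}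
    {U : Set M} (hU : IsOpen U) (h : IsAEMorphismOn A B f U) {x : M} (hxU : x ∈ U)
    (hx : x ∈ Reg A) (hfx : f x ∈ Reg B) : IsMorphismAt A B f x := by
  obtain ⟨hc, W, V', ⟨hWo, hWU, hWd, hWl⟩, -, -, hm⟩ := h
  obtain ⟨e, he, hxe⟩ := FlatSing.mem_Reg.1 hx
  obtain ⟨e', he', hxe'⟩ := FlatSing.mem_Reg.1 hfx
  have hcx : ContinuousAt f x := hc.continuousAt (hU.mem_nhds hxU)
  obtain ⟨V, hV, hVo, hVc, hxV⟩ := exists_isConnected_nhd e hxe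
    (inter_mem (hU.mem_nhds hxU) (hcx (e'.open_source.mem_nhds hxe')))
  have hcon := hWl V (fun y hy => (hV hy).1.1) hVo hVc
  obtain ⟨g, hg, H⟩ := exists_minkIsom_eqOn_of_dense (f := fun y => e' (f y)) (k := e)
    hcon.isPreconnected hcon.nonempty
    inter_subset_left
    (fun y hy => by
      have h1 : y ∈ closure W := hWd (hV hy).1.1
      exact mem_closure_iff.2 fun o ho hyo =>
        (mem_closure_iff.1 h1 (o ∩ V) (ho.inter hVo) ⟨hyo, hy⟩).mono
          fun z hz => ⟨hz.1.1, hz.1.2, hz.2⟩)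
    (e'.continuousOn.comp (hc.mono fun y hy => (hV hy).1.1) fun y hy => (hV hy).1.2)
    (e.continuousOn.mono fun y hy => (hV hy).2)
    (fun y hy => (e.map_nhds_eq (hV hy.1).2).ge) (fun y hy => by
      obtain ⟨g, hg, H⟩ := (hm y hy.2).exists_eq hA hB
        (hm y hy.2).continuousAt he (hV hy.1).2 he' (hV hy.1).1.2
      exact ⟨g, hg, H.mono fun z hz => hz.2⟩)
  refine ⟨e, he, e', he', hxe, g, hg, ?_⟩
  filter_upwards [hVo.mem_nhds hxV] with y hy using ⟨(hV hy).1.2, H y hy⟩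

lemma IsAEMorphismOn.mono {f : M → N} {U U' : Set M} (h : IsAEMorphismOn A B f U)
    (hU' : IsOpen U') (hUU : U' ⊆ U) : IsAEMorphismOn A B f U' := by
  obtain ⟨hc, W, V, ⟨hWo, hWU, hWd, hWl⟩, hV, hmaps, hm⟩ := h
  refine ⟨hc.mono hUU, W ∩ U', V, ⟨hWo.inter hU', fun y hy => ⟨hy.2, (hWU hy.1).2⟩, ?_, ?_⟩, hV,
    hmaps.mono_left inter_subset_left, fun x hx => hm x hx.1⟩
  · intro y hy
    exact mem_closure_iff.2 fun o ho hyo =>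
      (mem_closure_iff.1 (hWd (hUU hy)) (o ∩ U') (ho.inter hU') ⟨hyo, hy⟩).mono
        fun z hz => ⟨hz.1.1, hz.2, hz.1.2⟩
  · intro O hO hOo hOc
    have : O ∩ (W ∩ U') = O ∩ W := by
      ext z; exact ⟨fun hz => ⟨hz.1, hz.2.1⟩, fun hz => ⟨hz.1, hz.2, hO hz.1⟩⟩
    rw [this]
    exact hWl O (hO.trans hUU) hOo hOc

/-- The inverse of an almost everywhere morphism which is an open embedding is one, too. -/
lemma IsAEMorphismOn.symm (hA : IsAEStructure A) {f : OpenPartialHomeomorph M N}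
    (h : IsAEMorphismOn A B f f.source) : IsAEMorphismOn B A f.symm f.symm.source := by
  obtain ⟨hc, W, V, ⟨hWo, hWU, hWd, hWl⟩, -, -, hm⟩ := h
  have hWs : W ⊆ f.source := fun y hy => (hWU hy).1
  refine ⟨f.continuousOn_symm, f '' W, Reg A, ⟨?_, ?_, ?_, ?_⟩,
    ⟨isOpen_Reg, Subset.rfl, hA.dense_Reg, hA.locallyConnectedIn_Reg⟩, ?_, ?_⟩
  · exact f.isOpen_image_of_subset_source hWo hWs
  · rintro _ ⟨y, hy, rfl⟩
    exact ⟨f.map_source (hWs hy), (hm y hy).mem_Reg.2⟩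
  · intro y hy
    have h1 : f.symm y ∈ closure W := hWd (f.map_target hy)
    have h2 := mem_closure_image (f.continuousAt (f.map_target hy)) h1
    rwa [f.right_inv hy] at h2
  · intro O hO hOo hOc
    have hO' : O ⊆ f.target := hO
    have h1 : IsConnected (f.symm '' O) := hOc.image _ (f.continuousOn_symm.mono hO')
    have h2 := hWl (f.symm '' O) (by
      rintro _ ⟨y, hy, rfl⟩; exact f.map_target (hO' hy))
      (f.symm.isOpen_image_of_subset_source hOo hO') h1
    have h3 : O ∩ f '' W = f '' (f.symm '' O ∩ W) := by
      ext z
      constructor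
      · rintro ⟨hz, w, hw, rfl⟩
        exact ⟨w, ⟨⟨f w, hz, f.left_inv (hWs hw)⟩, hw⟩, rfl⟩
      · rintro ⟨w, ⟨⟨y, hy, rfl⟩, hw⟩, rfl⟩
        refine ⟨?_, _, hw, rfl⟩
        rw [f.right_inv (hO' hy)]; exact hy
    rw [h3]
    exact h2.image _ (f.continuousOn.mono fun y hy => hWs hy.2)
  · rintro _ ⟨y, hy, rfl⟩
    rw [f.left_inv (hWs hy)]; exact (hWU hy).2
  · rintro _ ⟨y, hy, rfl⟩
    exact (hm y hy).symm (hWs hy)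

lemma IsAEMorphismOn.trans (hB : IsAEStructure B) {f : OpenPartialHomeomorph M N}
    {f' : OpenPartialHomeomorph N K} (h : IsAEMorphismOn A B f f.source)
    (h' : IsAEMorphismOn B C f' f'.source) :
    IsAEMorphismOn A C (f.trans f') (f.trans f').source := by
  obtain ⟨hc, W, V, ⟨hWo, hWU, hWd, hWl⟩, -, -, hm⟩ := h
  obtain ⟨hc', W', V', ⟨hWo', hWU', hWd', hWl'⟩, hV', hmaps', hm'⟩ := h'
  have hWs : W ⊆ f.source := fun y hy => (hWU hy).1
  have hWs' : W' ⊆ f'.source := fun y hy => (hWU' hy).1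
  have hsrc : (f.trans f').source = f.source ∩ f ⁻¹' f'.source := f.trans_source f'
  refine ⟨(f.trans f').continuousOn, W ∩ f ⁻¹' W', V', ⟨?_, ?_, ?_, ?_⟩, hV', ?_, ?_⟩
  · exact f.continuousOn.mono hWs |>.isOpen_inter_preimage hWo hWo'
  · rintro y ⟨hy, hy'⟩
    exact ⟨hsrc ▸ ⟨hWs hy, hWs' hy'⟩, (hWU hy).2⟩
  · intro y hy
    rw [hsrc] at hy
    refine mem_closure_iff.2 fun o ho hyo => ?_
    -- a point of `f '' (o ∩ source)` in `W'`, whose preimage is then moved into `W`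
    have h1 : IsOpen (f '' (f.source ∩ o)) :=
      f.isOpen_image_of_subset_source (f.open_source.inter ho) inter_subset_left
    obtain ⟨z, ⟨w, hw, rfl⟩, hz'⟩ := mem_closure_iff.1 (hWd' hy.2) _ h1 ⟨y, ⟨hy.1, hyo⟩, rfl⟩
    have h2 : IsOpen ((f.source ∩ o) ∩ f ⁻¹' W') :=
      f.continuousOn.mono inter_subset_left |>.isOpen_inter_preimage (f.open_source.inter ho) hWo'
    obtain ⟨v, hv, hvW⟩ := mem_closure_iff.1 (hWd hw.1) _ h2 ⟨hw, hz'⟩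
    exact ⟨v, hv.1.2, hvW, hv.2⟩
  · intro O hO hOo hOc
    rw [hsrc] at hO
    have h1 := hWl O (fun y hy => (hO hy).1) hOo hOc
    have hs : O ∩ W ⊆ f.source := fun y hy => hWs hy.2
    have h2 := hWl' (f '' (O ∩ W)) (by
      rintro _ ⟨y, hy, rfl⟩; exact (hO hy.1).2)
      (f.isOpen_image_of_subset_source (hOo.inter hWo) hs)
      (h1.image _ (f.continuousOn.mono hs))
    have h3 : O ∩ (W ∩ f ⁻¹' W') = f.symm '' (f '' (O ∩ W) ∩ W') := by
      ext z
      constructor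
      · rintro ⟨hz, hzW, hzW'⟩
        exact ⟨f z, ⟨⟨z, ⟨hz, hzW⟩, rfl⟩, hzW'⟩, f.left_inv (hWs hzW)⟩
      · rintro ⟨_, ⟨⟨y, hy, rfl⟩, hyW'⟩, rfl⟩
        rw [f.left_inv (hs hy)]
        exact ⟨hy.1, hy.2, hyW'⟩
    rw [h3]
    refine h2.image _ (f.continuousOn_symm.mono ?_)
    rintro _ ⟨⟨y, hy, rfl⟩, -⟩
    exact f.map_source (hs hy)
  · exact fun y hy => hmaps' hy.2
  · rintro y ⟨hy, hy'⟩
    exact IsMorphismAt.comp hB (hm' _ hy') (hm y hy)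

lemma IsAEMorphismOn.mem_Reg_of_apply_mem_Reg (hA : IsAEStructure A) (hB : IsAEStructure B)
    {f : OpenPartialHomeomorph M N} (h : IsAEMorphismOn A B f f.source) {x : M}
    (hx : x ∈ f.source) (hfx : f x ∈ Reg B) : x ∈ Reg A := by
  obtain ⟨e', he', hxe'⟩ := FlatSing.mem_Reg.1 hfx
  refine FlatSing.mem_Reg.2 ⟨f.trans e', fun a ha y hy => ?_, f.trans_source e' ▸ ⟨hx, hxe'⟩⟩
  rw [f.trans_source] at hy
  have ha' := hA.subset_regAtlas ha
  have hm := h.isMorphismAt hA hB f.open_source hy.1.1 (FlatSing.mem_Reg.2 ⟨a, ha', hy.2⟩)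
    (FlatSing.mem_Reg.2 ⟨e', he', hy.1.2⟩)
  obtain ⟨g, hg, H⟩ := hm.exists_eq hA hB hm.continuousAt ha' hy.2 he' hy.1.2
  refine ⟨g.symm, symm_mem_minkIsom hg, H.mono fun z hz => ?_⟩
  rw [OpenPartialHomeomorph.coe_trans, Function.comp_apply, hz.2, AffineEquiv.symm_apply_apply]

/-- An open embedding which is an almost everywhere morphism preserves and reflects regularity. -/
lemma IsAEMorphismOn.mem_Reg_iff (hA : IsAEStructure A) (hB : IsAEStructure B)
    {f : OpenPartialHomeomorph M N} (h : IsAEMorphismOn A B f f.source) {x : M}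
    (hx : x ∈ f.source) : x ∈ Reg A ↔ f x ∈ Reg B := by
  refine ⟨fun hxA => ?_, h.mem_Reg_of_apply_mem_Reg hA hB hx⟩
  refine (h.symm hA).mem_Reg_of_apply_mem_Reg hB hA (f.map_source hx) ?_
  rwa [f.left_inv hx]

/-- Unique continuation of morphisms. -/
lemma IsMorphismOn.eqOn_of_eventuallyEq [T2Space N] (hA : IsAEStructure A) (hB : IsAEStructure B)
    {S : Set M} (hS : IsPreconnected S) {f f' : M → N}
    (hf : IsMorphismOn A B f S) (hf' : IsMorphismOn A B f' S) {x₀ : M} (hx₀ : x₀ ∈ S)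
    (h : f =ᶠ[𝓝 x₀] f') : EqOn f f' S := by
  let u : Set M := {x | f =ᶠ[𝓝 x] f'}
  have hu : IsOpen u := isOpen_iff_mem_nhds.2 fun x hx => eventually_eventually_nhds.2 hx
  have hSu : S ⊆ u := by
    refine hS.subset_of_closure_inter_subset hu ⟨x₀, hx₀, h⟩ ?_
    rintro x ⟨hxu, hxS⟩
    have hcf := (hf x hxS).continuousAt
    have hcf' := (hf' x hxS).continuousAt
    have hxx : f x = f' x := by
      by_contra hne
      have hev : ∀ᶠ y in 𝓝 x, f y ≠ f' y := (hcf.ne_iff_eventually_ne hcf').1 hne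
      obtain ⟨o, hoo, ho, hxo⟩ := eventually_nhds_iff.1 hev
      obtain ⟨y, hyo, hyu⟩ := mem_closure_iff.1 hxu o ho hxo
      exact hoo y hyo (Filter.EventuallyEq.eq_of_nhds hyu)
    obtain ⟨e, he, hxe⟩ := FlatSing.mem_Reg.1 (hf x hxS).mem_Reg.1
    obtain ⟨e', he', hxe'⟩ := FlatSing.mem_Reg.1 (hf x hxS).mem_Reg.2
    obtain ⟨g, hg, H⟩ := (hf x hxS).exists_eq hA hB hcf he hxe he' hxe'
    obtain ⟨g', hg', H'⟩ := (hf' x hxS).exists_eq hA hB hcf' he hxe he' (hxx ▸ hxe')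
    obtain ⟨o, hoo, ho, hxo⟩ := eventually_nhds_iff.1
      (H.and (H'.and (e.open_source.mem_nhds hxe)))
    obtain ⟨y, hyo, hyu⟩ := mem_closure_iff.1 hxu o ho hxo
    have hgg : g = g' := by
      refine affineEquiv_eq_of_eventuallyEq (x := e y) ?_
      rw [← e.map_nhds_eq (hoo y hyo).2.2, eventually_map]
      filter_upwards [hyu, ho.mem_nhds hyo] with z h1 h2
      rw [← (hoo z h2).1.2, ← (hoo z h2).2.1.2, h1]
    filter_upwards [H, H'] with z h1 h2
    apply e'.injOn h1.1 h2.1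
    rw [h1.2, h2.2, hgg]
  exact fun x hx => Filter.EventuallyEq.eq_of_nhds (hSu hx)

end Structures

/-! ### The Minkowski product and Liouville's theorem -/

/-- The symmetric bilinear form of Minkowski space. -/
def mink (v w : E3) : ℝ := -(v 0 * w 0) + v 1 * w 1 + v 2 * w 2

lemma minkForm_add (v w : E3) : minkForm (v + w) = minkForm v + 2 * mink v w + minkForm w := by
  simp only [minkForm, mink, PiLp.add_apply]; ring

lemma mink_map_of_minkForm {L : E3 →ₗ[ℝ] E3} (hL : ∀ v, minkForm (L v) = minkForm v) (v w : E3) :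
    mink (L v) (L w) = mink v w := by
  have h1 := minkForm_add v w
  have h2 := minkForm_add (L v) (L w)
  rw [← map_add, hL, hL, hL] at h2
  linarith

lemma eq_zero_of_mink_eq_zero {v : E3} (h : ∀ w, mink v w = 0) : v = 0 := by
  ext i
  have := h (EuclideanSpace.single i 1)
  fin_cases i <;> simpa [mink] using this

lemma injective_of_minkForm {L : E3 →ₗ[ℝ] E3} (hL : ∀ v, minkForm (L v) = minkForm v) :
    Function.Injective L := by
  rw [injective_iff_map_eq_zero]
  intro v hv
  refine eq_zero_of_mink_eq_zero fun w => ?_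
  rw [← mink_map_of_minkForm hL, hv]
  simp [mink]

/-- The second derivative of a local isometry of Minkowski space vanishes: paired with the first
derivative it is symmetric in the first two and skew in the last two of its three arguments. -/
lemma fderiv_fderiv_eq_zero_of_minkForm {h : E3 → E3} {x : E3} (hc : ContDiffAt ℝ 2 h x)
    (hm : ∀ᶠ y in 𝓝 x, ∀ v, minkForm (fderiv ℝ h y v) = minkForm v) :
    fderiv ℝ (fderiv ℝ h) x = 0 := by
  set F := fderiv ℝ h with hF
  have hFd : HasFDerivAt F (fderiv ℝ F x) x :=
    ((hc.fderiv_right (m := 1) (by norm_num)).differentiableAt (by norm_num)).hasFDerivAt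
  set F' := fderiv ℝ F x with hF'
  have hsymm : ∀ u v, F' u v = F' v u := fun u v =>
    (hc.isSymmSndFDerivAt (by simp)).eq u v
  have hcoord : ∀ (v : E3) (i : Fin 3), HasFDerivAt (fun y => (F y v) i)
      (((EuclideanSpace.proj i : E3 →L[ℝ] ℝ).comp
        (ContinuousLinearMap.apply ℝ E3 v)).comp F') x := fun v i =>
    ((EuclideanSpace.proj i : E3 →L[ℝ] ℝ).comp
        (ContinuousLinearMap.apply ℝ E3 v)).hasFDerivAt.comp x hFd
  have hskew : ∀ u v w, mink (F' u v) (F x w) + mink (F' u w) (F x v) = 0 := by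
    intro u v w
    have h1 := ((((hcoord v 0).mul (hcoord w 0)).neg).add ((hcoord v 1).mul (hcoord w 1))).add
      ((hcoord v 2).mul (hcoord w 2))
    have h2 : HasFDerivAt (fun _ : E3 => mink v w) (0 : E3 →L[ℝ] ℝ) x := hasFDerivAt_const _ _
    have h3 := h1.unique (h2.congr_of_eventuallyEq (hm.mono fun y hy => by
      exact mink_map_of_minkForm (L := (F y : E3 →ₗ[ℝ] E3)) hy v w))
    have h4 := congrArg (fun L : E3 →L[ℝ] ℝ => L u) h3
    simp only [add_apply, neg_apply, smul_apply, ContinuousLinearMap.comp_apply, smul_eq_mul,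
      ContinuousLinearMap.apply_apply, PiLp.proj_apply, zero_apply] at h4
    simp only [mink]
    linarith
  have hzero : ∀ u v w, mink (F' u v) (F x w) = 0 := by
    intro u v w
    have e1 := hskew u v w
    have e2 := hskew w u v
    have e3 := hskew v w u
    rw [hsymm w u] at e2
    rw [hsymm v w, hsymm v u] at e3
    linarith
  have hsurj : Function.Surjective (F x) := LinearMap.injective_iff_surjective.1
    (injective_of_minkForm (L := (F x : E3 →ₗ[ℝ] E3)) hm.self_of_nhds)
  ext1 u
  ext1 v
  refine eq_zero_of_mink_eq_zero fun w => ?_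
  obtain ⟨w, rfl⟩ := hsurj w
  exact hzero u v w

/-- **Liouville's theorem**: a local isometry of Minkowski space preserving orientation and time
orientation is locally the restriction of an element of `Isom₀`. -/
lemma exists_minkIsom_of_fderiv {h : E3 → E3} {x : E3} (hc : ContDiffAt ℝ 2 h x)
    (hm : ∀ᶠ y in 𝓝 x, ∀ v, minkForm (fderiv ℝ h y v) = minkForm v)
    (hd : 0 < (fderiv ℝ h x).det)
    (ht : ∀ v, minkForm v < 0 → 0 < v 0 → 0 < (fderiv ℝ h x v) 0) :
    ∃ g ∈ minkIsom, ∀ᶠ y in 𝓝 x, h y = g y := by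
  have hcev := hc.eventually (by norm_num)
  obtain ⟨ε, hε, hball⟩ := Metric.eventually_nhds_iff_ball.1
    ((hcev.and (eventually_eventually_nhds.2 hm)))
  have hxb : x ∈ Metric.ball x ε := Metric.mem_ball_self hε
  have hpc : IsPreconnected (Metric.ball x ε) := (convex_ball x ε).isPreconnected
  have hconst : ∀ y ∈ Metric.ball x ε, fderiv ℝ h y = fderiv ℝ h x := fun y hy =>
    Metric.isOpen_ball.is_const_of_fderiv_eq_zero hpc
      (fun z hz => (((hball z hz).1.fderiv_right (m := 1) (by norm_num)).differentiableAt
        (by norm_num)).differentiableWithinAt)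
      (fun z hz => fderiv_fderiv_eq_zero_of_minkForm (hball z hz).1 (hball z hz).2) hy hxb
  set L := fderiv ℝ h x with hL
  have haff : ∀ y ∈ Metric.ball x ε, h y - L y = h x - L x := fun y hy =>
    Metric.isOpen_ball.is_const_of_fderiv_eq_zero (f := fun y => h y - L y) hpc
      (fun z hz => (((hball z hz).1.differentiableAt (by norm_num)).sub
        L.differentiableAt).differentiableWithinAt)
      (fun z hz => by
        rw [fderiv_fun_sub ((hball z hz).1.differentiableAt (by norm_num)) L.differentiableAt,
          hconst z hz, L.fderiv, sub_self]; rfl) hy hxb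
  let Le : E3 ≃ₗ[ℝ] E3 := LinearMap.equivOfDetNeZero (L : E3 →ₗ[ℝ] E3) hd.ne'
  have hLe : ∀ v, Le v = L v := fun v => rfl
  refine ⟨Le.toAffineEquiv.trans (AffineEquiv.constVAdd ℝ E3 (h x - L x)),
    ⟨fun v => hm.self_of_nhds v, hd, fun v hv h0 => ht v hv h0⟩, ?_⟩
  filter_upwards [Metric.ball_mem_nhds x hε] with y hy
  change h y = (h x - L x) + L y
  rw [← haff y hy, sub_add_cancel]

/-! ### The atlas of the model spaces -/

lemma modelAtlas_contDiffAt {α : ℝ} {e : OpenPartialHomeomorph E3 E3} (he : e ∈ modelAtlas α)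
    {p : E3} (hp : p ∈ e.source) : ContDiffAt ℝ ∞ e p :=
  he.2.1.contDiffAt (e.open_source.mem_nhds hp)

lemma exists_hasFDerivAt_modelAtlas {α : ℝ} {e : OpenPartialHomeomorph E3 E3}
    (he : e ∈ modelAtlas α) {p : E3} (hp : p ∈ e.source) :
    ∃ D : E3 ≃L[ℝ] E3, (D : E3 →L[ℝ] E3) = fderiv ℝ e p ∧ HasFDerivAt e (D : E3 →L[ℝ] E3) p := by
  refine ⟨(fderiv ℝ e p).toContinuousLinearEquivOfDetNeZero (he.2.2 p hp).2.1.ne',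
    ContinuousLinearMap.coe_toContinuousLinearEquivOfDetNeZero _ _, ?_⟩
  rw [ContinuousLinearMap.coe_toContinuousLinearEquivOfDetNeZero]
  exact ((modelAtlas_contDiffAt he hp).differentiableAt (by simp)).hasFDerivAt

lemma modelAtlas_contDiffAt_symm {α : ℝ} {e : OpenPartialHomeomorph E3 E3} (he : e ∈ modelAtlas α)
    {p : E3} (hp : p ∈ e.source) : ContDiffAt ℝ ∞ e.symm (e p) := by
  obtain ⟨D, -, hD⟩ := exists_hasFDerivAt_modelAtlas he hp
  rw [← e.left_inv hp] at hD
  refine e.contDiffAt_symm (e.map_source hp) hD ?_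
  rw [e.left_inv hp]; exact modelAtlas_contDiffAt he hp

lemma modelMetric_neg (α : ℝ) (p v : E3) : modelMetric α p (-v) = modelMetric α p v := by
  simp only [modelMetric, dr, rdθ, PiLp.neg_apply]
  split_ifs <;> ring

lemma modelMetric_nonneg_of_zero (α : ℝ) (p : E3) {v : E3} (h : v 0 = 0) :
    0 ≤ modelMetric α p v := by
  simp only [modelMetric, h]
  split_ifs
  · rw [mul_zero, zero_mul, zero_add]; positivity
  · rw [zero_pow two_ne_zero, neg_zero, zero_add]; positivity

lemma compatible_modelAtlas {α : ℝ} {e e' : OpenPartialHomeomorph E3 E3} (he : e ∈ modelAtlas α)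
    (he' : e' ∈ modelAtlas α) : Compatible e e' := by
  rintro p ⟨hp, hp'⟩
  have hder : ∀ q ∈ e.source ∩ e'.source, ∃ D : E3 ≃L[ℝ] E3, (D : E3 →L[ℝ] E3) = fderiv ℝ e q ∧
      HasFDerivAt (fun y => e' (e.symm y)) ((fderiv ℝ e' q).comp (D.symm : E3 →L[ℝ] E3))
        (e q) := by
    rintro q ⟨hq, hq'⟩
    obtain ⟨D, hD, hDd⟩ := exists_hasFDerivAt_modelAtlas he hq
    refine ⟨D, hD, ?_⟩
    rw [← e.left_inv hq] at hDd
    have h1 := e.hasFDerivAt_symm (e.map_source hq) hDd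
    have h2 : HasFDerivAt e' (fderiv ℝ e' q) (e.symm (e q)) := by
      rw [e.left_inv hq]
      exact ((modelAtlas_contDiffAt he' hq').differentiableAt (by simp)).hasFDerivAt
    exact h2.comp (e q) h1
  have hform : ∀ q ∈ e.source ∩ e'.source, ∀ v,
      minkForm (fderiv ℝ (fun y => e' (e.symm y)) (e q) v) = minkForm v := by
    intro q hq v
    obtain ⟨D, hD, hDd⟩ := hder q hq
    rw [hDd.fderiv, ContinuousLinearMap.comp_apply, (he'.2.2 q hq.2).1, ← (he.2.2 q hq.1).1, ← hD]
    simp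
  have hO : e.source ∩ e'.source ∈ 𝓝 p :=
    inter_mem (e.open_source.mem_nhds hp) (e'.open_source.mem_nhds hp')
  have hO' : ∀ᶠ y in 𝓝 (e p), e.symm y ∈ e.source ∩ e'.source ∧ y ∈ e.target :=
    ((e.tendsto_symm hp).eventually hO).and (e.open_target.mem_nhds (e.map_source hp))
  obtain ⟨D, hD, hDd⟩ := hder p ⟨hp, hp'⟩
  obtain ⟨g, hg, H⟩ := exists_minkIsom_of_fderiv (h := fun y => e' (e.symm y)) (x := e p) (by
      have h1 : ContDiffAt ℝ ∞ e' (e.symm (e p)) := by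
        rw [e.left_inv hp]; exact modelAtlas_contDiffAt he' hp'
      exact (h1.comp (e p) (modelAtlas_contDiffAt_symm he hp)).of_le (by
          change ((2 : ℕ∞) : WithTop ℕ∞) ≤ _; exact_mod_cast le_top))
    (hO'.mono fun y hy v => by
      have := hform _ hy.1 v
      rwa [e.right_inv hy.2] at this)
    (by
      rw [hDd.fderiv]
      have h1 : ((fderiv ℝ e' p).comp (D.symm : E3 →L[ℝ] E3)).det * (fderiv ℝ e p).det
          = (fderiv ℝ e' p).det := by
        rw [← hD]
        simp only [ContinuousLinearMap.det]
        rw [← LinearMap.det_comp]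
        congr 1
        ext v : 1
        simp
      have h2 := (he'.2.2 p hp').2.1
      rw [← h1] at h2
      exact pos_of_mul_pos_left h2 (he.2.2 p hp).2.1.le)
    (fun v hv h0 => by
      rw [hDd.fderiv, ContinuousLinearMap.comp_apply]
      have hDv : ∀ w, fderiv ℝ e p w = D w := fun w => by rw [← hD]; rfl
      have h1 : modelMetric α p (D.symm v) < 0 := by
        rw [← (he.2.2 p hp).1, hDv]; simpa using hv
      refine (he'.2.2 p hp').2.2 _ h1 ?_
      by_contra! hneg
      rcases hneg.lt_or_eq with hlt | heq
      · have h3 := (he.2.2 p hp).2.2 (-(D.symm v)) (by rwa [modelMetric_neg])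
          (by rw [PiLp.neg_apply]; exact neg_pos.2 hlt)
        rw [hDv, map_neg, ContinuousLinearEquiv.apply_symm_apply, PiLp.neg_apply] at h3
        linarith
      · exact absurd h1 (not_lt.2 (modelMetric_nonneg_of_zero α p heq)))
  refine ⟨g, hg, ?_⟩
  filter_upwards [(e.continuousAt hp).eventually H, e.open_source.mem_nhds hp] with y hy hys
  rwa [e.left_inv hys] at hy

/-! ### Polar coordinates and the developing maps -/

/-- The linear map of `ℝ³` with a given matrix. -/
noncomputable def matCLM (M : Matrix (Fin 3) (Fin 3) ℝ) : E3 →L[ℝ] E3 :=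
  LinearMap.toContinuousLinearMap (Matrix.toEuclideanLin M)

lemma matCLM_apply (M : Matrix (Fin 3) (Fin 3) ℝ) (v : E3) (i : Fin 3) :
    matCLM M v i = M i 0 * v 0 + M i 1 * v 1 + M i 2 * v 2 := by
  change (Matrix.toEuclideanLin M v) i = _
  simp [Matrix.toEuclideanLin, Matrix.mulVec, dotProduct, Fin.sum_univ_three]

lemma matCLM_det (M : Matrix (Fin 3) (Fin 3) ℝ) : (matCLM M).det = M.det := by
  simp only [matCLM, ContinuousLinearMap.det, LinearMap.coe_toContinuousLinearMap]
  change LinearMap.det (Matrix.toLpLin 2 2 M) = _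
  rw [Matrix.toLpLin_eq_toLin, LinearMap.det_toLin]

lemma hasFDerivAt_of_coord {f : E3 → E3} {M : Matrix (Fin 3) (Fin 3) ℝ} {q : E3}
    (h : ∀ i, HasFDerivAt (fun y => f y i) (M i 0 • (EuclideanSpace.proj 0 : E3 →L[ℝ] ℝ) +
      M i 1 • (EuclideanSpace.proj 1 : E3 →L[ℝ] ℝ) +
      M i 2 • (EuclideanSpace.proj 2 : E3 →L[ℝ] ℝ)) q) : HasFDerivAt f (matCLM M) q := by
  rw [← hasFDerivWithinAt_univ, hasFDerivWithinAt_euclidean]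
  intro i
  refine ((h i).congr_fderiv ?_).hasFDerivWithinAt
  ext v
  exact (matCLM_apply M v i).symm

lemma hasFDerivAt_coord (i : Fin 3) (q : E3) :
    HasFDerivAt (fun y : E3 => y i) (EuclideanSpace.proj i : E3 →L[ℝ] ℝ) q :=
  (EuclideanSpace.proj i : E3 →L[ℝ] ℝ).hasFDerivAt

/-- Cylindrical coordinates `(t, r, θ) ↦ (t, r cos (a θ), r sin (a θ))`, with cone angle `2π a`. -/
noncomputable def cone (a : ℝ) (q : E3) : E3 := !₂[q 0, q 1 * Real.cos (a * q 2), q 1 * Real.sin (a * q 2)]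

/-- The cylindrical coordinates `(t, r, θ)` of `ℝ³`. -/
noncomputable def polar (q : E3) : E3 := cone 1 q

/-- The developing map of `𝔼^{1,2}_α`, in cylindrical coordinates. -/
noncomputable def dev (α : ℝ) (q : E3) : E3 :=
  if α = 0 then !₂[q 0 + q 1 * q 2 ^ 2 / 2, q 1 - q 0 - q 1 * q 2 ^ 2 / 2, q 1 * q 2]
  else cone (α / (2 * Real.pi)) q

@[simp] lemma cone_zero (a : ℝ) (q : E3) : cone a q 0 = q 0 := rfl
@[simp] lemma cone_one (a : ℝ) (q : E3) : cone a q 1 = q 1 * Real.cos (a * q 2) := rfl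
@[simp] lemma cone_two (a : ℝ) (q : E3) : cone a q 2 = q 1 * Real.sin (a * q 2) := rfl
@[simp] lemma polar_zero (q : E3) : polar q 0 = q 0 := rfl
@[simp] lemma polar_one (q : E3) : polar q 1 = q 1 * Real.cos (q 2) := by simp [polar]
@[simp] lemma polar_two (q : E3) : polar q 2 = q 1 * Real.sin (q 2) := by simp [polar]

lemma dev_of_ne {α : ℝ} (h : α ≠ 0) : dev α = cone (α / (2 * Real.pi)) := by
  ext1 q; simp [dev, h]

lemma dev_zero_zero (q : E3) : dev 0 q 0 = q 0 + q 1 * q 2 ^ 2 / 2 := by simp [dev]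
lemma dev_zero_one (q : E3) : dev 0 q 1 = q 1 - q 0 - q 1 * q 2 ^ 2 / 2 := by simp [dev]
lemma dev_zero_two (q : E3) : dev 0 q 2 = q 1 * q 2 := by simp [dev]

/-- The Jacobian matrix of `cone a`. -/
noncomputable def coneMat (a : ℝ) (q : E3) : Matrix (Fin 3) (Fin 3) ℝ :=
  !![1, 0, 0; 0, Real.cos (a * q 2), -(a * q 1 * Real.sin (a * q 2));
    0, Real.sin (a * q 2), a * q 1 * Real.cos (a * q 2)]

/-- The Jacobian matrix of `dev 0`. -/
noncomputable def nullMat (q : E3) : Matrix (Fin 3) (Fin 3) ℝ :=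
  !![1, q 2 ^ 2 / 2, q 1 * q 2; -1, 1 - q 2 ^ 2 / 2, -(q 1 * q 2); 0, q 2, q 1]

/-- The Jacobian matrix of `dev α`. -/
noncomputable def devMat (α : ℝ) (q : E3) : Matrix (Fin 3) (Fin 3) ℝ :=
  if α = 0 then nullMat q else coneMat (α / (2 * Real.pi)) q

lemma hasFDerivAt_cone (a : ℝ) (q : E3) : HasFDerivAt (cone a) (matCLM (coneMat a q)) q := by
  have h2 := (hasFDerivAt_coord 2 q).const_mul a
  refine hasFDerivAt_of_coord fun i => ?_
  fin_cases i
  · refine (hasFDerivAt_coord 0 q).congr_fderiv ?_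
    ext v; simp [coneMat]
  · refine ((hasFDerivAt_coord 1 q).mul h2.cos).congr_fderiv ?_
    ext v; simp [coneMat]; ring
  · refine ((hasFDerivAt_coord 1 q).mul h2.sin).congr_fderiv ?_
    ext v; simp [coneMat]; ring

lemma hasFDerivAt_dev (α : ℝ) (q : E3) : HasFDerivAt (dev α) (matCLM (devMat α q)) q := by
  by_cases hα : α = 0
  · subst hα
    have h0 := hasFDerivAt_coord 0 q
    have h1 := hasFDerivAt_coord 1 q
    have h2 := hasFDerivAt_coord 2 q
    have h3 := (h1.mul (h2.mul h2)).const_mul (1 / 2)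
    refine hasFDerivAt_of_coord fun i => ?_
    fin_cases i
    · refine ((h0.add h3).congr_fderiv ?_).congr_of_eventuallyEq (Eventually.of_forall fun y => ?_)
      · ext v; simp [devMat, nullMat]; ring
      · simp only [Fin.zero_eta, dev_zero_zero, Pi.add_apply, Pi.mul_apply]; ring
    · refine (((h1.sub h0).sub h3).congr_fderiv ?_).congr_of_eventuallyEq
        (Eventually.of_forall fun y => ?_)
      · ext v; simp [devMat, nullMat]; ring
      · simp only [Fin.mk_one, dev_zero_one, Pi.sub_apply, Pi.mul_apply]; ring
    · refine ((h1.mul h2).congr_fderiv ?_).congr_of_eventuallyEq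
        (Eventually.of_forall fun y => ?_)
      · ext v; simp [devMat, nullMat]; ring
      · simp only [Fin.reduceFinMk, dev_zero_two, Pi.mul_apply]
  · rw [dev_of_ne hα, devMat, if_neg hα]
    exact hasFDerivAt_cone _ q

lemma contDiff_cone (a : ℝ) : ContDiff ℝ ∞ (cone a) := by
  rw [contDiff_euclidean]
  intro i
  have h : ∀ j : Fin 3, ContDiff ℝ ∞ fun y : E3 => y j := fun j =>
    (EuclideanSpace.proj j : E3 →L[ℝ] ℝ).contDiff
  have h2 := (contDiff_const (c := a)).mul (h 2)
  fin_cases i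
  · exact h 0
  · exact (h 1).mul h2.cos
  · exact (h 1).mul h2.sin

lemma contDiff_dev (α : ℝ) : ContDiff ℝ ∞ (dev α) := by
  by_cases hα : α = 0
  · subst hα
    rw [contDiff_euclidean]
    intro i
    have h : ∀ j : Fin 3, ContDiff ℝ ∞ fun y : E3 => y j := fun j =>
      (EuclideanSpace.proj j : E3 →L[ℝ] ℝ).contDiff
    fin_cases i
    · simp only [Fin.zero_eta, dev_zero_zero]
      exact (h 0).add (((h 1).mul ((h 2).pow 2)).div_const 2)
    · simp only [Fin.mk_one, dev_zero_one]
      exact ((h 1).sub (h 0)).sub (((h 1).mul ((h 2).pow 2)).div_const 2)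
    · simp only [Fin.reduceFinMk, dev_zero_two]
      exact (h 1).mul (h 2)
  · rw [dev_of_ne hα]; exact contDiff_cone _

lemma contDiff_polar : ContDiff ℝ ∞ polar := contDiff_cone 1

lemma hasFDerivAt_polar (q : E3) : HasFDerivAt polar (matCLM (coneMat 1 q)) q :=
  hasFDerivAt_cone 1 q

lemma coneMat_det_pos {a : ℝ} (ha : 0 < a) {q : E3} (hq : 0 < q 1) : 0 < (coneMat a q).det := by
  have : (coneMat a q).det = a * q 1 * (Real.cos (a * q 2) ^ 2 + Real.sin (a * q 2) ^ 2) := by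
    simp [coneMat, Matrix.det_fin_three, -Real.cos_sq_add_sin_sq]; ring
  rw [this, Real.cos_sq_add_sin_sq]; positivity

lemma devMat_det_pos {α : ℝ} (hα : 0 ≤ α) {q : E3} (hq : 0 < q 1) : 0 < (devMat α q).det := by
  rcases hα.eq_or_lt with rfl | h
  · have : (devMat 0 q).det = q 1 := by
      simp [devMat, nullMat, Matrix.det_fin_three]; ring
    rwa [this]
  · rw [devMat, if_neg h.ne']
    exact coneMat_det_pos (by positivity) hq

lemma radius_nonneg (p : E3) : 0 ≤ radius p := Real.sqrt_nonneg _

lemma radius_sq (p : E3) : radius p ^ 2 = p 1 ^ 2 + p 2 ^ 2 := Real.sq_sqrt (by positivity)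

lemma radius_eq_zero_iff {p : E3} : radius p = 0 ↔ p 1 = 0 ∧ p 2 = 0 := by
  rw [radius, Real.sqrt_eq_zero (by positivity)]
  constructor
  · intro h
    constructor <;> nlinarith [sq_nonneg (p 1), sq_nonneg (p 2)]
  · rintro ⟨h1, h2⟩; rw [h1, h2]; simp

lemma continuous_coord (i : Fin 3) : Continuous fun p : E3 => p i :=
  (EuclideanSpace.proj i : E3 →L[ℝ] ℝ).continuous

lemma continuous_radius : Continuous radius :=
  (((continuous_coord 1).pow 2).add ((continuous_coord 2).pow 2)).sqrt

lemma radius_cone (a : ℝ) {q : E3} (hq : 0 ≤ q 1) : radius (cone a q) = q 1 := by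
  have : (cone a q 1) ^ 2 + (cone a q 2) ^ 2 = q 1 ^ 2 := by
    rw [cone_one, cone_two]
    linear_combination q 1 ^ 2 * Real.cos_sq_add_sin_sq (a * q 2)
  rw [radius, this, Real.sqrt_sq hq]

lemma radius_polar {q : E3} (hq : 0 ≤ q 1) : radius (polar q) = q 1 := radius_cone 1 hq

/-- The Jacobian of the developing map transports the metric of `𝔼^{1,2}_α` to the one of
Minkowski space. -/
lemma minkForm_devMat {α : ℝ} {q : E3} (hq : 0 < q 1) (w : E3) :
    minkForm (matCLM (devMat α q) w) =
      modelMetric α (polar q) (matCLM (coneMat 1 q) w) := by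
  have hs := Real.cos_sq_add_sin_sq (q 2)
  have h1 : dr (polar q) (matCLM (coneMat 1 q) w) = w 1 := by
    rw [dr, radius_polar hq.le, div_eq_iff hq.ne']
    simp only [matCLM_apply, coneMat, polar_one, polar_two]
    simp
    linear_combination q 1 * w 1 * hs
  have h2 : rdθ (polar q) (matCLM (coneMat 1 q) w) = q 1 * w 2 := by
    rw [rdθ, radius_polar hq.le, div_eq_iff hq.ne']
    simp only [matCLM_apply, coneMat, polar_one, polar_two]
    simp
    linear_combination q 1 * q 1 * w 2 * hs
  have h0 : matCLM (coneMat 1 q) w 0 = w 0 := by simp [matCLM_apply, coneMat]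
  rw [modelMetric, h1, h2, h0, devMat]
  split_ifs with hα
  · simp only [minkForm, matCLM_apply, nullMat]
    simp
    ring
  · simp only [minkForm, matCLM_apply, coneMat]
    simp
    linear_combination (w 1 ^ 2 + (α / (2 * Real.pi) * q 1 * w 2) ^ 2) *
      Real.cos_sq_add_sin_sq (α / (2 * Real.pi) * q 2)

/-- The developing map is time-orientation preserving. -/
lemma devMat_future {α : ℝ} {q : E3} (w : E3)
    (hw : minkForm (matCLM (devMat α q) w) < 0) (h0 : 0 < w 0) :
    0 < matCLM (devMat α q) w 0 := by
  rw [devMat] at hw ⊢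
  split_ifs at hw ⊢ with hα
  · simp only [minkForm, matCLM_apply, nullMat] at hw ⊢
    simp at hw ⊢
    have hw' : w 1 ^ 2 + (q 1 * w 2) ^ 2 < 2 * w 0 * w 1 := by nlinarith
    have h1 : 0 < w 1 := by
      by_contra! hneg
      nlinarith [sq_nonneg (w 1), sq_nonneg (q 1 * w 2), mul_nonneg h0.le (neg_nonneg.2 hneg)]
    -- `2 w₁` times the claim is a square plus a positive term
    have : 0 < 2 * w 1 * (w 0 + q 2 ^ 2 / 2 * w 1 + q 1 * q 2 * w 2) := by
      nlinarith [sq_nonneg (q 2 * w 1 + q 1 * w 2), sq_pos_of_pos h1]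
    exact pos_of_mul_pos_right this (by positivity)
  · simpa [matCLM_apply, coneMat] using h0

lemma exists_polar_eq (p : E3) : ∃ q : E3, q 1 = radius p ∧ q 0 = p 0 ∧
    polar q = p := by
  let z : ℂ := ⟨p 1, p 2⟩
  have hz : ‖z‖ = radius p := by
    rw [Complex.norm_def, Complex.normSq_apply, radius]
    congr 1; simp only [z]; ring
  refine ⟨!₂[p 0, radius p, Complex.arg z], rfl, rfl, ?_⟩
  ext i
  fin_cases i
  · rfl
  · refine (polar_one _).trans ?_
    change radius p * Real.cos (Complex.arg z) = z.re
    rw [← hz, Complex.norm_mul_cos_arg]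
  · refine (polar_two _).trans ?_
    change radius p * Real.sin (Complex.arg z) = z.im
    rw [← hz, Complex.norm_mul_sin_arg]

lemma isOpen_pos_one : IsOpen {q : E3 | 0 < q 1} := isOpen_lt continuous_const (continuous_coord 1)

lemma exists_equiv_matCLM {M : Matrix (Fin 3) (Fin 3) ℝ} (hM : 0 < M.det) :
    ∃ D : E3 ≃L[ℝ] E3, (D : E3 →L[ℝ] E3) = matCLM M := by
  have : (matCLM M).det ≠ 0 := by rw [matCLM_det]; exact hM.ne'
  exact ⟨_, ContinuousLinearMap.coe_toContinuousLinearEquivOfDetNeZero _ this⟩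

/-- The inverse function theorem for maps of `ℝ³` given with their Jacobian matrices. -/
lemma exists_openPartialHomeomorph {f : E3 → E3} {M : E3 → Matrix (Fin 3) (Fin 3) ℝ}
    (hf : ContDiff ℝ ∞ f) (hfM : ∀ q, HasFDerivAt f (matCLM (M q)) q)
    (hM : ∀ q : E3, 0 < q 1 → 0 < (M q).det) {q : E3} (hq : 0 < q 1) :
    ∃ e : OpenPartialHomeomorph E3 E3, ⇑e = f ∧ q ∈ e.source ∧ ∀ y ∈ e.source, 0 < y 1 := by
  obtain ⟨D, hD⟩ := exists_equiv_matCLM (hM q hq)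
  have h1 : HasFDerivAt f (D : E3 →L[ℝ] E3) q := hD ▸ hfM q
  refine ⟨(hf.contDiffAt.toOpenPartialHomeomorph f h1 (by simp)).restrOpen _ isOpen_pos_one, rfl,
    ⟨hf.contDiffAt.mem_toOpenPartialHomeomorph_source h1 (by simp), hq⟩, fun y hy => hy.2⟩

lemma map_nhds_dev {α : ℝ} (hα : 0 ≤ α) {q : E3} (hq : 0 < q 1) :
    map (dev α) (𝓝 q) = 𝓝 (dev α q) := by
  obtain ⟨e, he, hqe, -⟩ := exists_openPartialHomeomorph (contDiff_dev α) (hasFDerivAt_dev α)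
    (fun q hq => devMat_det_pos hα hq) hq
  rw [← he]; exact e.map_nhds_eq hqe

lemma exists_polar_chart {q : E3} (hq : 0 < q 1) :
    ∃ e : OpenPartialHomeomorph E3 E3, ⇑e = polar ∧ q ∈ e.source ∧ ∀ y ∈ e.source, 0 < y 1 :=
  exists_openPartialHomeomorph contDiff_polar hasFDerivAt_polar
    (fun _ hq => coneMat_det_pos one_pos hq) hq

lemma map_nhds_polar {q : E3} (hq : 0 < q 1) : map polar (𝓝 q) = 𝓝 (polar q) := by
  obtain ⟨e, he, hqe, -⟩ := exists_polar_chart hq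
  rw [← he]; exact e.map_nhds_eq hqe

/-- The local inverses of the cylindrical coordinates, followed by the developing map, are charts
of `𝔼^{1,2}_α`. -/
lemma exists_modelAtlas_dev {α : ℝ} (hα : 0 ≤ α) {q : E3} (hq : 0 < q 1) :
    ∃ e ∈ modelAtlas α, polar q ∈ e.source ∧ ∀ᶠ y in 𝓝 q, e (polar y) = dev α y := by
  obtain ⟨P, hP, hqP, hP0⟩ := exists_polar_chart hq
  obtain ⟨D, hD, hqD, hD0⟩ := exists_openPartialHomeomorph (contDiff_dev α) (hasFDerivAt_dev α)
    (fun q hq => devMat_det_pos hα hq) hq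
  have hsrc : ∀ p ∈ (P.symm.trans D).source, p ∈ P.target ∧ 0 < (P.symm p) 1 ∧
      polar (P.symm p) = p := fun p hp => by
    rw [OpenPartialHomeomorph.trans_source] at hp
    exact ⟨hp.1, hD0 _ hp.2, by rw [← hP]; exact P.right_inv hp.1⟩
  have hsymm : ∀ p ∈ (P.symm.trans D).source, ∃ L : E3 ≃L[ℝ] E3,
      (L : E3 →L[ℝ] E3) = matCLM (coneMat 1 (P.symm p)) ∧
      HasFDerivAt P.symm (L.symm : E3 →L[ℝ] E3) p := fun p hp => by
    obtain ⟨L, hL⟩ := exists_equiv_matCLM (coneMat_det_pos one_pos (hsrc p hp).2.1)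
    refine ⟨L, hL, P.hasFDerivAt_symm (hsrc p hp).1 ?_⟩
    rw [hP, hL]; exact hasFDerivAt_polar _
  refine ⟨P.symm.trans D, ⟨fun p hp => ?_, fun p hp => ?_, fun p hp => ?_⟩, ?_, ?_⟩
  · obtain ⟨-, h1, h2⟩ := hsrc p hp
    rw [← h2, radius_polar h1.le]; exact h1
  · obtain ⟨L, hL, hd⟩ := hsymm p hp
    have h1 : ContDiffAt ℝ ∞ P.symm p := P.contDiffAt_symm (f₀' := L) (hsrc p hp).1
      (by rw [hP, hL]; exact hasFDerivAt_polar _) (by rw [hP]; exact contDiff_polar.contDiffAt)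
    rw [OpenPartialHomeomorph.coe_trans, hD]
    exact ((contDiff_dev α).contDiffAt.comp p h1).contDiffWithinAt
  · obtain ⟨-, h1, h2⟩ := hsrc p hp
    obtain ⟨L, hL, hd⟩ := hsymm p hp
    have hL' : ∀ v, matCLM (coneMat 1 (P.symm p)) v = L v := fun v => by rw [← hL]; rfl
    have h3 : HasFDerivAt (P.symm.trans D)
        ((matCLM (devMat α (P.symm p))).comp (L.symm : E3 →L[ℝ] E3)) p := by
      rw [OpenPartialHomeomorph.coe_trans, hD]
      exact (hasFDerivAt_dev α (P.symm p)).comp p hd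
    rw [h3.fderiv]
    have hform : ∀ v, minkForm (matCLM (devMat α (P.symm p)) (L.symm v)) = modelMetric α p v := by
      intro v
      rw [minkForm_devMat h1, h2, hL', ContinuousLinearEquiv.apply_symm_apply]
    refine ⟨hform, ?_, fun v hv h0 => ?_⟩
    · have h4 : ((matCLM (devMat α (P.symm p))).comp (L.symm : E3 →L[ℝ] E3)).det *
          (matCLM (coneMat 1 (P.symm p))).det = (matCLM (devMat α (P.symm p))).det := by
        rw [← hL]
        simp only [ContinuousLinearMap.det]
        rw [← LinearMap.det_comp]
        congr 1
        ext v : 1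
        simp
      rw [matCLM_det, matCLM_det] at h4
      have h5 := devMat_det_pos hα h1
      rw [← h4] at h5
      exact pos_of_mul_pos_left h5 (coneMat_det_pos one_pos h1).le
    · refine devMat_future (L.symm v) ((hform v).trans_lt hv) ?_
      have : v 0 = (L.symm v) 0 := by
        conv_lhs => rw [← L.apply_symm_apply v, ← hL']
        simp [matCLM_apply, coneMat]
      exact this ▸ h0
  · rw [OpenPartialHomeomorph.trans_source]
    refine ⟨?_, ?_⟩
    · rw [← hP]; exact P.map_source hqP
    · rw [mem_preimage, ← hP, P.left_inv hqP]; exact hqD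
  · filter_upwards [P.open_source.mem_nhds hqP] with y hy
    rw [OpenPartialHomeomorph.coe_trans, Function.comp_apply, ← hP, P.left_inv hy, hD]

/-! ### The complement of the axis -/

/-- If `W` is dense in the preconnected open set `V`, and every point of `V` has a neighbourhood
in `V` meeting `W` in a preconnected set, then `V ∩ W` is preconnected. -/
lemma isPreconnected_inter_of_locally {X : Type*} [TopologicalSpace X] {V W : Set X}
    (hV : IsPreconnected V) (hVo : IsOpen V) (hVW : Dense W)
    (h : ∀ x ∈ V, ∃ O ∈ 𝓝 x, O ⊆ V ∧ IsPreconnected (O ∩ W)) : IsPreconnected (V ∩ W) := by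
  intro u v hu hv huv ⟨x, hx, hxu⟩ ⟨y, hy, hyv⟩
  by_contra hne
  have hdisj : ∀ z ∈ V ∩ W, z ∈ u → z ∉ v := fun z hz hzu hzv => hne ⟨z, hz, hzu, hzv⟩
  let u' : Set X := {x | ∀ᶠ y in 𝓝 x, y ∈ W → y ∈ u}
  let v' : Set X := {x | ∀ᶠ y in 𝓝 x, y ∈ W → y ∈ v}
  have hu' : IsOpen u' := isOpen_iff_mem_nhds.2 fun x hx => eventually_eventually_nhds.2 hx
  have hv' : IsOpen v' := isOpen_iff_mem_nhds.2 fun x hx => eventually_eventually_nhds.2 hx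
  have hcov : V ⊆ u' ∪ v' := by
    intro z hz
    obtain ⟨O, hO, hOV, hOc⟩ := h z hz
    by_cases hmeet : (O ∩ W ∩ u).Nonempty
    · left
      filter_upwards [hO] with w hwO hwW
      by_contra hwu
      have hwv : w ∈ v := (huv ⟨hOV hwO, hwW⟩).resolve_left hwu
      obtain ⟨a, ha, hau, hav⟩ := hOc u v hu hv (fun a ha => huv ⟨hOV ha.1, ha.2⟩) hmeet
        ⟨w, ⟨hwO, hwW⟩, hwv⟩
      exact hdisj a ⟨hOV ha.1, ha.2⟩ hau hav
    · right
      filter_upwards [hO] with w hwO hwW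
      exact (huv ⟨hOV hwO, hwW⟩).resolve_left fun hwu => hmeet ⟨w, ⟨hwO, hwW⟩, hwu⟩
  obtain ⟨z, hzV, hzu, hzv⟩ := hV u' v' hu' hv' hcov
    ⟨x, hx.1, mem_of_superset (hu.mem_nhds hxu) fun _ h _ => h⟩
    ⟨y, hy.1, mem_of_superset (hv.mem_nhds hyv) fun _ h _ => h⟩
  obtain ⟨o, ho, hoo, hzo⟩ := eventually_nhds_iff.1 ((hzu.and hzv).and (hVo.mem_nhds hzV))
  obtain ⟨w, hwo, hwW⟩ := hVW.inter_open_nonempty o hoo ⟨z, hzo⟩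
  exact hdisj w ⟨(ho w hwo).2, hwW⟩ ((ho w hwo).1.1 hwW) ((ho w hwo).1.2 hwW)

/-- The complement of the axis. -/
def offAxis : Set E3 := {p | 0 < radius p}

lemma isOpen_offAxis : IsOpen offAxis := isOpen_lt continuous_const continuous_radius

lemma notMem_offAxis {p : E3} : p ∉ offAxis ↔ radius p = 0 := by
  rw [offAxis, mem_ofPred_eq, not_lt]
  exact ⟨fun h => le_antisymm h (radius_nonneg p), fun h => h.le⟩

/-- A solid cylinder around the axis, minus the axis, in cylindrical coordinates. -/
def cyl (t ε : ℝ) : Set E3 := {q | |q 0 - t| < ε ∧ 0 < q 1 ∧ q 1 < ε}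

lemma isOpen_cyl (t ε : ℝ) : IsOpen (cyl t ε) :=
  ((isOpen_lt (((continuous_coord 0).sub continuous_const).abs) continuous_const).inter
    (isOpen_pos_one.inter (isOpen_lt (continuous_coord 1) continuous_const)))

lemma convex_cyl (t ε : ℝ) : Convex ℝ (cyl t ε) := by
  have h0 : IsLinearMap ℝ fun q : E3 => q 0 := ⟨fun _ _ => rfl, fun _ _ => rfl⟩
  have h1 : IsLinearMap ℝ fun q : E3 => q 1 := ⟨fun _ _ => rfl, fun _ _ => rfl⟩
  have : cyl t ε = ({q | q 0 < t + ε} ∩ {q | t - ε < q 0}) ∩ ({q | 0 < q 1} ∩ {q | q 1 < ε}) := by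
    ext q
    simp only [cyl, mem_ofPred_eq, mem_inter_iff, abs_lt]
    constructor
    · rintro ⟨⟨h1, h2⟩, h3⟩
      exact ⟨⟨by linarith, by linarith⟩, h3⟩
    · rintro ⟨⟨h1, h2⟩, h3⟩
      exact ⟨⟨by linarith, by linarith⟩, h3⟩
  rw [this]
  exact ((convex_halfSpace_lt h0 _).inter (convex_halfSpace_gt h0 _)).inter
    ((convex_halfSpace_gt h1 _).inter (convex_halfSpace_lt h1 _))

lemma mem_cyl_mk {t ε r : ℝ} (hr : 0 < r) (hrε : r < ε) (θ : ℝ) :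
    (!₂[t, r, θ] : E3) ∈ cyl t ε := by
  refine ⟨?_, hr, hrε⟩
  change |t - t| < ε
  simpa using hr.trans hrε

lemma cyl_nonempty {t ε : ℝ} (hε : 0 < ε) : (cyl t ε).Nonempty :=
  ⟨_, mem_cyl_mk (half_pos hε) (half_lt_self hε) 0⟩

lemma isConnected_cyl {t ε : ℝ} (hε : 0 < ε) : IsConnected (cyl t ε) :=
  ⟨cyl_nonempty hε, (convex_cyl t ε).isPreconnected⟩

lemma polar_image_cyl (t ε : ℝ) :
    polar '' cyl t ε = {p : E3 | |p 0 - t| < ε ∧ radius p < ε} ∩ offAxis := by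
  ext p
  constructor
  · rintro ⟨q, ⟨h0, h1, h2⟩, rfl⟩
    have := radius_polar h1.le
    exact ⟨⟨h0, this ▸ h2⟩, show 0 < radius (polar q) from this ▸ h1⟩
  · rintro ⟨⟨h0, h2⟩, h1⟩
    obtain ⟨q, hq1, hq0, rfl⟩ := exists_polar_eq p
    exact ⟨q, ⟨h0, hq1 ▸ h1, hq1 ▸ h2⟩, rfl⟩

lemma exists_cylinder_subset {x : E3} (hx : radius x = 0) {O : Set E3} (hO : O ∈ 𝓝 x) :
    ∃ ε > 0, {p : E3 | |p 0 - x 0| < ε ∧ radius p < ε} ⊆ O := by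
  obtain ⟨δ, hδ, hb⟩ := Metric.mem_nhds_iff.1 hO
  refine ⟨δ / 2, half_pos hδ, fun p ⟨h0, hr⟩ => hb ?_⟩
  obtain ⟨h1, h2⟩ := radius_eq_zero_iff.1 hx
  rw [Metric.mem_ball, EuclideanSpace.dist_eq, Real.sqrt_lt' hδ, Fin.sum_univ_three]
  simp only [Real.dist_eq, sq_abs, h1, h2, sub_zero]
  have h3 : (p 0 - x 0) ^ 2 < (δ / 2) ^ 2 := sq_lt_sq' (abs_lt.1 h0).1 (abs_lt.1 h0).2
  have h4 : radius p ^ 2 < (δ / 2) ^ 2 := by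
    have := radius_nonneg p
    exact pow_lt_pow_left₀ hr this two_ne_zero
  rw [radius_sq] at h4
  nlinarith

lemma dense_offAxis : Dense offAxis := by
  intro x
  by_cases hx : x ∈ offAxis
  · exact subset_closure hx
  rw [notMem_offAxis] at hx
  refine mem_closure_iff_nhds.2 fun O hO => ?_
  obtain ⟨ε, hε, h⟩ := exists_cylinder_subset hx hO
  have h1 : (polar '' cyl (x 0) ε).Nonempty := (cyl_nonempty hε).image _
  rw [polar_image_cyl] at h1
  exact h1.mono (inter_subset_inter_left _ h)

lemma locallyConnectedIn_offAxis : LocallyConnectedIn offAxis univ := by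
  intro V _ hVo hVc
  refine ⟨dense_offAxis.inter_open_nonempty V hVo hVc.nonempty,
    isPreconnected_inter_of_locally hVc.isPreconnected hVo dense_offAxis fun x hxV => ?_⟩
  by_cases hx : x ∈ offAxis
  · obtain ⟨ε, hε, hb⟩ := Metric.mem_nhds_iff.1
      (inter_mem (hVo.mem_nhds hxV) (isOpen_offAxis.mem_nhds hx))
    refine ⟨Metric.ball x ε, Metric.ball_mem_nhds x hε, fun y hy => (hb hy).1, ?_⟩
    rw [inter_eq_left.2 fun y hy => (hb hy).2]
    exact (convex_ball x ε).isPreconnected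
  · rw [notMem_offAxis] at hx
    obtain ⟨ε, hε, h⟩ := exists_cylinder_subset hx (hVo.mem_nhds hxV)
    refine ⟨_, ?_, h, ?_⟩
    · refine IsOpen.mem_nhds ((isOpen_lt (((continuous_coord 0).sub continuous_const).abs)
        continuous_const).inter (isOpen_lt continuous_radius continuous_const)) ⟨?_, ?_⟩
      · simpa using hε
      · simpa [hx] using hε
    · rw [← polar_image_cyl]
      exact (isConnected_cyl hε).isPreconnected.image _ contDiff_polar.continuous.continuousOn

/-! ### The model spaces as spaces with an almost everywhere structure -/

lemma biUnion_modelAtlas {α : ℝ} (hα : 0 ≤ α) : ⋃ e ∈ modelAtlas α, e.source = offAxis := by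
  ext p
  simp only [mem_iUnion]
  constructor
  · rintro ⟨e, he, hp⟩
    exact he.1 p hp
  · intro hp
    obtain ⟨q, hq, -, rfl⟩ := exists_polar_eq p
    obtain ⟨e, he, hpe, -⟩ := exists_modelAtlas_dev hα (q := q) (hq ▸ hp)
    exact ⟨e, he, hpe⟩

lemma isAEStructure_modelAtlas {α : ℝ} (hα : 0 ≤ α) : IsAEStructure (modelAtlas α) where
  compatible _ he _ he' := compatible_modelAtlas he he'
  dense := by rw [biUnion_modelAtlas hα]; exact dense_offAxis
  locallyConnected := by rw [biUnion_modelAtlas hα]; exact locallyConnectedIn_offAxis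

lemma offAxis_subset_Reg {α : ℝ} (hα : 0 ≤ α) : offAxis ⊆ Reg (modelAtlas α) := by
  rw [← biUnion_modelAtlas hα]
  exact biUnion_subset_biUnion_left (isAEStructure_modelAtlas hα).subset_regAtlas

/-- In cylindrical coordinates every chart of `𝔼^{1,2}_α` is the developing map, up to `Isom₀`. -/
lemma exists_eventuallyEq_dev {α : ℝ} (hα : 0 ≤ α) {e : OpenPartialHomeomorph E3 E3}
    (he : e ∈ regAtlas (modelAtlas α)) {q : E3} (hq : 0 < q 1) (hqe : polar q ∈ e.source) :
    ∃ g ∈ minkIsom, ∀ᶠ y in 𝓝 q, e (polar y) = g (dev α y) := by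
  obtain ⟨c, hc, hqc, H⟩ := exists_modelAtlas_dev hα hq
  obtain ⟨g, hg, h⟩ := he c hc (polar q) ⟨hqe, hqc⟩
  refine ⟨g.symm, symm_mem_minkIsom hg, ?_⟩
  filter_upwards [H, contDiff_polar.continuous.continuousAt.eventually h] with y h1 h2
  rw [← h1, h2, AffineEquiv.symm_apply_apply]

/-- Off the axis the metric of `𝔼^{1,2}_{2π}` is the one of Minkowski space. -/
lemma modelMetric_two_pi {p : E3} (hp : 0 < radius p) (v : E3) :
    modelMetric (2 * Real.pi) p v = minkForm v := by
  have hpi : 2 * Real.pi ≠ 0 := by positivity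
  rw [modelMetric, if_neg hpi, div_self hpi, minkForm, dr, rdθ]
  have := radius_sq p
  field_simp
  linear_combination (-v 1 ^ 2 - v 2 ^ 2) * this

lemma refl_mem_regAtlas_two_pi :
    OpenPartialHomeomorph.refl E3 ∈ regAtlas (modelAtlas (2 * Real.pi)) := by
  rintro e he p ⟨-, hp⟩
  have h := he.2.2 p hp
  have hev : ∀ᶠ y in 𝓝 p, ∀ v, minkForm (fderiv ℝ e y v) = minkForm v := by
    filter_upwards [e.open_source.mem_nhds hp] with y hy v
    rw [(he.2.2 y hy).1, modelMetric_two_pi (he.1 y hy)]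
  refine exists_minkIsom_of_fderiv ((modelAtlas_contDiffAt he hp).of_le (by
    change ((2 : ℕ∞) : WithTop ℕ∞) ≤ _; exact_mod_cast le_top)) hev h.2.1 fun v hv h0 => ?_
  exact h.2.2 v (by rwa [modelMetric_two_pi (he.1 p hp)]) h0

lemma Reg_two_pi : Reg (modelAtlas (2 * Real.pi)) = univ :=
  eq_univ_of_forall fun _ => mem_Reg.2 ⟨_, refl_mem_regAtlas_two_pi, mem_univ _⟩

/-- The translation by `s` of the angular coordinate. -/
noncomputable def shift (s : ℝ) (q : E3) : E3 := !₂[q 0, q 1, q 2 + s]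

@[simp] lemma shift_zero (s : ℝ) (q : E3) : shift s q 0 = q 0 := rfl
@[simp] lemma shift_one (s : ℝ) (q : E3) : shift s q 1 = q 1 := rfl
@[simp] lemma shift_two (s : ℝ) (q : E3) : shift s q 2 = q 2 + s := rfl

lemma shift_mem_cyl {t ε s : ℝ} {q : E3} (hq : q ∈ cyl t ε) : shift s q ∈ cyl t ε := hq

lemma continuous_shift (s : ℝ) : Continuous (shift s) := by
  refine (PiLp.continuous_toLp 2 _).comp (continuous_pi fun i => ?_)
  fin_cases i
  · exact continuous_coord 0
  · exact continuous_coord 1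
  · exact (continuous_coord 2).add continuous_const

lemma polar_shift_two_pi (q : E3) : polar (shift (2 * Real.pi) q) = polar q := by
  ext i
  fin_cases i
  · rfl
  · simp
  · simp

/-- `𝔼^{1,2}_{2πm}` is a cyclic covering of Minkowski space of degree `m`, branched along the
axis. -/
lemma cone_shift {m : ℤ} (hm : m ≠ 0) (q : E3) :
    cone m (shift (2 * Real.pi / m) q) = cone m q := by
  have hm' : (m : ℝ) ≠ 0 := Int.cast_ne_zero.2 hm
  have h : (m : ℝ) * (q 2 + 2 * Real.pi / m) = m * q 2 + 2 * Real.pi := by field_simp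
  ext i
  fin_cases i
  · rfl
  · change q 1 * Real.cos (m * (q 2 + 2 * Real.pi / m)) = q 1 * Real.cos (m * q 2)
    rw [h, Real.cos_add_two_pi]
  · change q 1 * Real.sin (m * (q 2 + 2 * Real.pi / m)) = q 1 * Real.sin (m * q 2)
    rw [h, Real.sin_add_two_pi]

/-- Proper rational fractions of a full turn move the points off the axis. -/
lemma polar_shift_ne {m : ℤ} (hm : 2 ≤ |m|) {q : E3} (hq : 0 < q 1) :
    polar (shift (2 * Real.pi / m) q) ≠ polar q := by
  intro h
  have h1 := congrArg (fun p : E3 => p 1) h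
  have h2 := congrArg (fun p : E3 => p 2) h
  simp only [polar_one, polar_two, shift_one, shift_two, mul_eq_mul_left_iff, hq.ne', or_false]
    at h1 h2
  have h3 : Real.cos (2 * Real.pi / m) = 1 := by
    have : 2 * Real.pi / m = (q 2 + 2 * Real.pi / m) - q 2 := by ring
    rw [this, Real.cos_sub, h1, h2, ← sq, ← sq, Real.cos_sq_add_sin_sq]
  obtain ⟨n, hn⟩ := (Real.cos_eq_one_iff _).1 h3
  have hm0 : m ≠ 0 := by rintro rfl; simp at hm
  have hm' : (m : ℝ) ≠ 0 := Int.cast_ne_zero.2 hm0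
  field_simp at hn
  have h4 : n * m = 1 := by exact_mod_cast hn
  have h5 : |n| * |m| = 1 := by rw [← abs_mul, h4, abs_one]
  have h6 : 0 < |n| := abs_pos.2 (by rintro rfl; simp at h4)
  nlinarith

lemma exists_int_of_cos_eq_one {α : ℝ} (hα : 0 < α) (hα2 : α ≠ 2 * Real.pi)
    (h : Real.cos α = 1) : ∃ m : ℤ, 2 ≤ m ∧ α / (2 * Real.pi) = m := by
  obtain ⟨m, hm⟩ := (Real.cos_eq_one_iff _).1 h
  have hpi := Real.pi_pos
  refine ⟨m, ?_, by rw [← hm]; field_simp⟩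
  have h0 : 0 < m := by
    by_contra! hneg
    have : (m : ℝ) ≤ 0 := by exact_mod_cast hneg
    nlinarith
  have h1 : m ≠ 1 := by
    rintro rfl
    exact hα2 (by rw [← hm]; simp)
  omega

/-- There is no chart with values in Minkowski space around a point of the axis of
`𝔼^{1,2}_α`, `α ≠ 2π`: its pull-back to the cylindrical coordinates would be the developing map,
so that the latter is `2π`-periodic in the angle, and then it is a branched covering of degree at
least two. -/
lemma not_injOn_of_eventuallyEq_dev {α : ℝ} (hα : 0 ≤ α) (hα2 : α ≠ 2 * Real.pi) {U : Set E3}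
    {x : E3} (hU : U ∈ 𝓝 x) (hx : radius x = 0) {ψ : E3 → E3}
    (h : ∀ q : E3, 0 < q 1 → polar q ∈ U → ∃ g ∈ minkIsom, ∀ᶠ y in 𝓝 q, ψ (polar y) = g (dev α y)) :
    ¬ InjOn ψ (U ∩ offAxis) := by
  intro hinj
  obtain ⟨ε, hε, hεU⟩ := exists_cylinder_subset hx hU
  have hcyl : ∀ q ∈ cyl (x 0) ε, polar q ∈ U ∩ offAxis := fun q hq => by
    have := mem_image_of_mem polar hq
    rw [polar_image_cyl] at this
    exact ⟨hεU this.1, this.2⟩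
  obtain ⟨g, hg, H⟩ := exists_minkIsom_eventuallyEq (f := fun q => ψ (polar q))
    (isConnected_cyl (t := x 0) hε).isPreconnected (cyl_nonempty hε)
    (fun q hq => (map_nhds_dev hα hq.2.1).ge) fun q hq => h q hq.2.1 (hcyl q hq).1
  have H' : ∀ q ∈ cyl (x 0) ε, ψ (polar q) = g (dev α q) := fun q hq => (H q hq).self_of_nhds
  have hper : ∀ q ∈ cyl (x 0) ε, dev α (shift (2 * Real.pi) q) = dev α q := fun q hq =>
    g.injective (by rw [← H' q hq, ← H' _ (shift_mem_cyl hq), polar_shift_two_pi])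
  have hq := mem_cyl_mk (t := x 0) (half_pos hε) (half_lt_self hε) 0
  set q : E3 := !₂[x 0, ε / 2, 0] with hqdef
  rcases hα.eq_or_lt with rfl | hpos
  · have := congrArg (fun p : E3 => p 2) (hper q hq)
    simp [dev_zero_two, hqdef, hε.ne', Real.pi_ne_zero] at this
  · have h1 := congrArg (fun p : E3 => p 1) (hper q hq)
    rw [dev_of_ne hpos.ne'] at h1
    have h2 : α / (2 * Real.pi) * (2 * Real.pi) = α := by field_simp
    simp [hqdef, hε.ne', h2] at h1
    obtain ⟨m, hm, hmα⟩ := exists_int_of_cos_eq_one hpos hα2 h1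
    refine polar_shift_ne (m := m) (hm.trans (le_abs_self m)) hq.2.1
      (hinj (hcyl _ (shift_mem_cyl hq)) (hcyl _ hq) ?_)
    rw [H' q hq, H' _ (shift_mem_cyl hq), dev_of_ne hpos.ne', hmα, cone_shift (by omega)]

lemma Reg_modelAtlas {α : ℝ} (hα : 0 ≤ α) (hα2 : α ≠ 2 * Real.pi) :
    Reg (modelAtlas α) = offAxis := by
  refine Subset.antisymm (fun p hp => ?_) (offAxis_subset_Reg hα)
  by_contra hpa
  obtain ⟨e, he, hpe⟩ := mem_Reg.1 hp
  exact not_injOn_of_eventuallyEq_dev hα hα2 (e.open_source.mem_nhds hpe) (notMem_offAxis.1 hpa)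
    (fun q hq hqe => exists_eventuallyEq_dev hα he hq hqe) (e.injOn.mono inter_subset_left)

lemma ne_two_pi_of_mem_Sing {α : ℝ} {p : E3} (hp : p ∈ Sing (modelAtlas α)) :
    α ≠ 2 * Real.pi := by
  rintro rfl
  exact hp (Reg_two_pi ▸ mem_univ p)

lemma mem_Sing_modelAtlas {α : ℝ} (hα : 0 ≤ α) (hα2 : α ≠ 2 * Real.pi) {p : E3} :
    p ∈ Sing (modelAtlas α) ↔ radius p = 0 := by
  rw [Sing, Reg_modelAtlas hα hα2, mem_compl_iff, notMem_offAxis]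

/-! ### Lifting morphisms to the cylindrical coordinates, and holonomy -/

/-- A continuous function on a connected set with values in `ℤ c` is constant. -/
lemma exists_int_mul_of_continuousOn {X : Type*} [TopologicalSpace X] {S : Set X}
    (hS : IsConnected S) {f : X → ℝ} (hf : ContinuousOn f S) {c : ℝ} (hc : c ≠ 0)
    (h : ∀ x ∈ S, ∃ n : ℤ, f x = n * c) : ∃ n : ℤ, ∀ x ∈ S, f x = n * c := by
  classical
  choose! n hn using h
  have hcont : ContinuousOn n S := by
    rw [Int.isClosedEmbedding_coe_real.isEmbedding.continuousOn_iff]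
    refine (hf.div_const c).congr fun x hx => ?_
    simp only [Function.comp_apply]
    rw [hn x hx, mul_div_cancel_right₀ _ hc]
  obtain ⟨x₀, hx₀⟩ := hS.nonempty
  exact ⟨n x₀, fun x hx => by rw [hn x hx, hS.isPreconnected.constant hcont hx hx₀]⟩

lemma exists_int_of_cos_sin_eq {a b : ℝ} (hc : Real.cos a = Real.cos b)
    (hs : Real.sin a = Real.sin b) : ∃ n : ℤ, a - b = n * (2 * Real.pi) := by
  have : Real.cos (a - b) = 1 := by
    rw [Real.cos_sub, hc, hs, ← sq, ← sq, Real.cos_sq_add_sin_sq]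
  obtain ⟨n, hn⟩ := (Real.cos_eq_one_iff _).1 this
  exact ⟨n, hn.symm⟩

lemma cone_eq_cone {a : ℝ} {p q : E3} (hp : 0 < p 1) (hq : 0 < q 1) (h : cone a p = cone a q) :
    p 0 = q 0 ∧ p 1 = q 1 ∧ ∃ n : ℤ, a * p 2 - a * q 2 = n * (2 * Real.pi) := by
  have h1 : p 1 = q 1 := by rw [← radius_cone a hp.le, ← radius_cone a hq.le, h]
  have hc := congrArg (fun v : E3 => v 1) h
  have hs := congrArg (fun v : E3 => v 2) h
  simp only [cone_one, cone_two, h1, mul_eq_mul_left_iff, hq.ne', or_false] at hc hs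
  have h0 := congrArg (fun v : E3 => v 0) h
  exact ⟨h0, h1, exists_int_of_cos_sin_eq hc hs⟩

lemma polar_eq_polar {p q : E3} (hp : 0 < p 1) (hq : 0 < q 1) (h : polar p = polar q) :
    p 0 = q 0 ∧ p 1 = q 1 ∧ ∃ n : ℤ, p 2 - q 2 = n * (2 * Real.pi) := by
  simpa using cone_eq_cone (a := 1) hp hq h

/-- A map of the cylindrical coordinates lifting the morphism `φ`, defined on the cylinder
`cyl t ε`, together with the element of `Isom₀` which it induces through the developing maps. -/
structure IsLift (α β : ℝ) (φ : E3 → E3) (t ε : ℝ) (g : E3 ≃ᵃ[ℝ] E3) (Λ : E3 → E3) : Prop where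
  pos : 0 < ε
  mem : g ∈ minkIsom
  continuousOn : ContinuousOn Λ (cyl t ε)
  pos_one : ∀ q ∈ cyl t ε, 0 < Λ q 1
  polar_eq : ∀ q ∈ cyl t ε, polar (Λ q) = φ (polar q)
  dev_eq : ∀ q ∈ cyl t ε, dev β (Λ q) = g (dev α q)

/-- Since the cylinder `cyl t ε` is simply connected, a morphism with values off the axis lifts
to it. -/
lemma exists_isLift {α β : ℝ} (hα : 0 ≤ α) (hβ : 0 ≤ β) {t ε : ℝ} (hε : 0 < ε) {φ : E3 → E3}
    (hφ : ∀ q ∈ cyl t ε, IsMorphismAt (modelAtlas α) (modelAtlas β) φ (polar q))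
    (hoff : ∀ q ∈ cyl t ε, φ (polar q) ∈ offAxis) :
    ∃ g Λ, IsLift α β φ t ε g Λ := by
  have hpolar : Continuous polar := contDiff_polar.continuous
  have hcφ : ContinuousOn (fun q => φ (polar q)) (cyl t ε) := fun q hq =>
    ((hφ q hq).continuousAt.comp (f := polar) hpolar.continuousAt).continuousWithinAt
  let z : E3 → ℂ := fun q => (φ (polar q) 1 : ℂ) + (φ (polar q) 2 : ℂ) * Complex.I
  have hz : ContinuousOn z (cyl t ε) :=
    (Complex.continuous_ofReal.comp_continuousOn ((continuous_coord 1).comp_continuousOn hcφ)).add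
      ((Complex.continuous_ofReal.comp_continuousOn
        ((continuous_coord 2).comp_continuousOn hcφ)).mul continuousOn_const)
  have hsc : IsSimplyConnected (cyl t ε) := by
    have := (convex_cyl t ε).contractibleSpace (cyl_nonempty hε)
    exact (inferInstance : SimplyConnectedSpace (cyl t ε))
  have hz0 : 0 ∉ z '' cyl t ε := by
    rintro ⟨q, hq, h0⟩
    have h1 := congrArg Complex.re h0
    have h2 := congrArg Complex.im h0
    simp [z] at h1 h2
    exact (hoff q hq).ne' (radius_eq_zero_iff.2 ⟨h1, h2⟩)
  obtain ⟨l, hlc, hl⟩ := Complex.exists_continuousOn_eqOn_exp_comp hsc (isOpen_cyl t ε) hz hz0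
  let Λ : E3 → E3 := fun q => !₂[φ (polar q) 0, Real.exp (l q).re, (l q).im]
  have hΛc : ContinuousOn Λ (cyl t ε) := by
    refine (PiLp.continuous_toLp 2 _).comp_continuousOn (continuousOn_pi.2 fun i => ?_)
    fin_cases i
    · exact (continuous_coord 0).comp_continuousOn hcφ
    · exact (Real.continuous_exp.comp Complex.continuous_re).comp_continuousOn hlc
    · exact Complex.continuous_im.comp_continuousOn hlc
  have hΛ1 : ∀ q, 0 < Λ q 1 := fun q => Real.exp_pos _
  have hΛp : ∀ q ∈ cyl t ε, polar (Λ q) = φ (polar q) := by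
    intro q hq
    have h := hl hq
    simp only [Function.comp_apply, z] at h
    have h1 := congrArg Complex.re h
    have h2 := congrArg Complex.im h
    rw [Complex.exp_re] at h1
    rw [Complex.exp_im] at h2
    simp at h1 h2
    ext i
    fin_cases i
    · rfl
    · exact (polar_one _).trans h1
    · exact (polar_two _).trans h2
  have hloc : ∀ q ∈ cyl t ε, ∃ g ∈ minkIsom, ∀ᶠ y in 𝓝 q, dev β (Λ y) = g (dev α y) := by
    intro q hq
    obtain ⟨c, hc, hqc, H⟩ := exists_modelAtlas_dev hα hq.2.1
    obtain ⟨c', hc', hqc', H'⟩ := exists_modelAtlas_dev hβ (hΛ1 q)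
    obtain ⟨g, hg, h⟩ := (hφ q hq).exists_eq (isAEStructure_modelAtlas hα)
      (isAEStructure_modelAtlas hβ) (hφ q hq).continuousAt
      ((isAEStructure_modelAtlas hα).subset_regAtlas hc) hqc
      ((isAEStructure_modelAtlas hβ).subset_regAtlas hc') (hΛp q hq ▸ hqc')
    refine ⟨g, hg, ?_⟩
    have hO := (isOpen_cyl t ε).mem_nhds hq
    filter_upwards [hO, H, (hΛc.continuousAt hO).eventually H',
      hpolar.continuousAt.eventually h] with y h1 h2 h3 h4
    rw [← h3, hΛp y h1, h4.2, h2]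
  obtain ⟨g, hg, H⟩ := exists_minkIsom_eventuallyEq (isConnected_cyl hε).isPreconnected
    (cyl_nonempty hε) (fun q hq => (map_nhds_dev hα hq.2.1).ge) hloc
  exact ⟨g, Λ, hε, hg, hΛc, fun q _ => hΛ1 q, hΛp, fun q hq => (H q hq).self_of_nhds⟩

/-- The matrix of the linear isometry by which the developing map changes under the translation
by `s` of the angle: a rotation for `α ≠ 0`, a parabolic isometry for `α = 0`. -/
noncomputable def holMat (α s : ℝ) : Matrix (Fin 3) (Fin 3) ℝ :=
  if α = 0 then !![1 + s ^ 2 / 2, s ^ 2 / 2, s; -(s ^ 2 / 2), 1 - s ^ 2 / 2, -s; s, s, 1]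
  else !![1, 0, 0; 0, Real.cos (α / (2 * Real.pi) * s), -Real.sin (α / (2 * Real.pi) * s);
    0, Real.sin (α / (2 * Real.pi) * s), Real.cos (α / (2 * Real.pi) * s)]

/-- The holonomy of `𝔼^{1,2}_α`. -/
noncomputable def hol (α s : ℝ) : E3 →L[ℝ] E3 := matCLM (holMat α s)

lemma hol_zero_apply (s : ℝ) (v : E3) :
    hol 0 s v 0 = v 0 + (s * v 2 + s ^ 2 / 2 * (v 0 + v 1)) ∧
    hol 0 s v 1 = v 1 - (s * v 2 + s ^ 2 / 2 * (v 0 + v 1)) ∧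
    hol 0 s v 2 = v 2 + s * (v 0 + v 1) := by
  refine ⟨?_, ?_, ?_⟩ <;> (rw [hol, matCLM_apply, holMat, if_pos rfl]; simp; ring)

lemma hol_apply {α : ℝ} (hα : α ≠ 0) (s : ℝ) (v : E3) :
    hol α s v 0 = v 0 ∧
    hol α s v 1 = Real.cos (α / (2 * Real.pi) * s) * v 1 - Real.sin (α / (2 * Real.pi) * s) * v 2 ∧
    hol α s v 2 = Real.sin (α / (2 * Real.pi) * s) * v 1 + Real.cos (α / (2 * Real.pi) * s) * v 2 := by
  refine ⟨?_, ?_, ?_⟩ <;> (rw [hol, matCLM_apply, holMat, if_neg hα]; simp [sub_eq_add_neg])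

lemma dev_shift (α s : ℝ) (q : E3) : dev α (shift s q) = hol α s (dev α q) := by
  by_cases hα : α = 0
  · subst hα
    obtain ⟨h0, h1, h2⟩ := hol_zero_apply s (dev 0 q)
    ext i
    fin_cases i
    · refine Eq.trans ?_ h0.symm
      simp only [Fin.zero_eta, dev_zero_zero, dev_zero_one, dev_zero_two, shift_zero, shift_one,
        shift_two]; ring
    · refine Eq.trans ?_ h1.symm
      simp only [Fin.mk_one, dev_zero_zero, dev_zero_one, dev_zero_two, shift_zero, shift_one,
        shift_two]; ring
    · refine Eq.trans ?_ h2.symm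
      simp only [Fin.reduceFinMk, dev_zero_zero, dev_zero_one, dev_zero_two, shift_one,
        shift_two]; ring
  · obtain ⟨h0, h1, h2⟩ := hol_apply hα s (dev α q)
    rw [dev_of_ne hα] at h0 h1 h2 ⊢
    ext i
    fin_cases i
    · exact h0.symm
    · refine Eq.trans ?_ h1.symm
      simp only [Fin.mk_one, cone_one, cone_two, shift_one, shift_two, mul_add, Real.cos_add]; ring
    · refine Eq.trans ?_ h2.symm
      simp only [Fin.reduceFinMk, cone_one, cone_two, shift_one, shift_two, mul_add, Real.sin_add]
      ring

namespace IsLift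

variable {α β t ε : ℝ} {φ : E3 → E3} {g : E3 ≃ᵃ[ℝ] E3} {Λ : E3 → E3}

lemma apply_shift (h : IsLift α β φ t ε g Λ) :
    ∃ k : ℤ, ∀ q ∈ cyl t ε, Λ (shift (2 * Real.pi) q) = shift (k * (2 * Real.pi)) (Λ q) := by
  have hpol : ∀ q ∈ cyl t ε, Λ (shift (2 * Real.pi) q) 0 = Λ q 0 ∧
      Λ (shift (2 * Real.pi) q) 1 = Λ q 1 ∧
      ∃ n : ℤ, Λ (shift (2 * Real.pi) q) 2 - Λ q 2 = n * (2 * Real.pi) := fun q hq => by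
    refine polar_eq_polar (h.pos_one _ (shift_mem_cyl hq)) (h.pos_one q hq) ?_
    rw [h.polar_eq _ (shift_mem_cyl hq), h.polar_eq q hq, polar_shift_two_pi]
  obtain ⟨k, hk⟩ := exists_int_mul_of_continuousOn (isConnected_cyl h.pos)
    (((continuous_coord 2).comp_continuousOn (h.continuousOn.comp
      (continuous_shift (2 * Real.pi)).continuousOn fun q hq => shift_mem_cyl hq)).sub
      ((continuous_coord 2).comp_continuousOn h.continuousOn)) (by positivity)
    fun q hq => (hpol q hq).2.2
  refine ⟨k, fun q hq => ?_⟩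
  ext i
  fin_cases i
  · exact (hpol q hq).1
  · exact (hpol q hq).2.1
  · have := hk q hq
    simp only [Function.comp_apply, Pi.sub_apply] at this
    change Λ (shift (2 * Real.pi) q) 2 = Λ q 2 + k * (2 * Real.pi)
    linarith

/-- `g` intertwines the holonomy of the source with a power of the one of the target. -/
lemma holonomy (hα : 0 ≤ α) (h : IsLift α β φ t ε g Λ) :
    ∃ k : ℤ, ∀ v, g (hol α (2 * Real.pi) v) = hol β (k * (2 * Real.pi)) (g v) := by
  obtain ⟨k, hk⟩ := h.apply_shift
  obtain ⟨q, hq⟩ := cyl_nonempty (t := t) h.pos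
  have H : ∀ᶠ v in 𝓝 (dev α q), (g : E3 →ᵃ[ℝ] E3).comp
      (hol α (2 * Real.pi) : E3 →ₗ[ℝ] E3).toAffineMap v =
      ((hol β (k * (2 * Real.pi)) : E3 →ₗ[ℝ] E3).toAffineMap.comp (g : E3 →ᵃ[ℝ] E3)) v := by
    rw [← map_nhds_dev hα hq.2.1, eventually_map]
    filter_upwards [(isOpen_cyl t ε).mem_nhds hq] with y hy
    change g (hol α (2 * Real.pi) (dev α y)) = hol β (k * (2 * Real.pi)) (g (dev α y))
    rw [← dev_shift, ← h.dev_eq y hy, ← h.dev_eq _ (shift_mem_cyl hy), hk y hy, dev_shift]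
  exact ⟨k, fun v => congrArg (fun a : E3 →ᵃ[ℝ] E3 => a v) (affineMap_eq_of_eventuallyEq H)⟩

/-- If `φ` is injective, then a lift does not factor through a branched covering. -/
lemma apply_shift_ne (h : IsLift α β φ t ε g Λ) (hinj : InjOn φ (polar '' cyl t ε)) {m : ℤ}
    (hm : 2 ≤ |m|) {q : E3} (hq : q ∈ cyl t ε) :
    polar (Λ (shift (2 * Real.pi / m) q)) ≠ polar (Λ q) := by
  rw [h.polar_eq _ (shift_mem_cyl hq), h.polar_eq q hq]
  exact fun heq => polar_shift_ne hm hq.2.1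
    (hinj (mem_image_of_mem _ (shift_mem_cyl hq)) (mem_image_of_mem _ hq) heq)

/-- If `φ` is injective and a lift multiplies the angles by `c`, then `c = ±1`. -/
lemma abs_angle_eq_one (h : IsLift α β φ t ε g Λ) (hinj : InjOn φ (polar '' cyl t ε)) {c : ℝ}
    (hc : c ≠ 0) (hΛ : ∀ q ∈ cyl t ε, ∀ s, Λ (shift s q) = shift (c * s) (Λ q)) : |c| = 1 := by
  obtain ⟨q, hq⟩ := cyl_nonempty (t := t) h.pos
  have h1 : polar (Λ (shift (2 * Real.pi) q)) = polar (Λ q) := by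
    rw [h.polar_eq _ (shift_mem_cyl hq), h.polar_eq q hq, polar_shift_two_pi]
  obtain ⟨-, -, n, hn⟩ := polar_eq_polar (h.pos_one _ (shift_mem_cyl hq)) (h.pos_one q hq) h1
  rw [hΛ q hq, shift_two, add_sub_cancel_left,
    mul_left_inj' (by positivity : (2 * Real.pi : ℝ) ≠ 0)] at hn
  subst hn
  have hn0 : n ≠ 0 := by exact_mod_cast hc
  have h2 : ¬ 2 ≤ |n| := fun hn2 => by
    refine h.apply_shift_ne hinj hn2 hq ?_
    rw [hΛ q hq, mul_div_cancel₀ _ hc, polar_shift_two_pi]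
  have h3 : 0 < |n| := abs_pos.2 hn0
  have h4 : |n| = 1 := by omega
  exact_mod_cast h4

end IsLift

/-! ### Injective morphisms near the axis -/

lemma minkIsom_apply (g : E3 ≃ᵃ[ℝ] E3) (v : E3) : g v = g.linear v + g 0 := by
  have := g.map_vadd 0 v
  simpa using this

lemma linear_eq_matCLM (L : E3 →ₗ[ℝ] E3) :
    ∀ v, L v = matCLM (Matrix.of fun i j => L (EuclideanSpace.single j 1) i) v := by
  intro v
  have hv : v = v 0 • EuclideanSpace.single 0 1 + v 1 • EuclideanSpace.single 1 1 +
      v 2 • EuclideanSpace.single 2 1 := by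
    ext i; fin_cases i <;> simp
  ext i
  rw [matCLM_apply]
  conv_lhs => rw [hv]
  simp only [map_add, map_smul, PiLp.add_apply, PiLp.smul_apply, smul_eq_mul, Matrix.of_apply]
  ring

lemma det_eq_det_of (L : E3 →ₗ[ℝ] E3) :
    LinearMap.det L = (Matrix.of fun i j => L (EuclideanSpace.single j 1) i).det := by
  rw [← matCLM_det, ContinuousLinearMap.det]
  congr 1
  ext v : 1
  exact linear_eq_matCLM L v

/-- A rotation does not act on any plane by a nontrivial shear. -/
lemma eq_zero_of_hol_shear {α : ℝ} (hα : α ≠ 0) {s c : ℝ} (hc : c ≠ 0) {w m : E3}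
    (hm : hol α s m = m) (hw : hol α s w = w + c • m) : m = 0 := by
  have hnorm : ∀ v, (hol α s v 0) ^ 2 + (hol α s v 1) ^ 2 + (hol α s v 2) ^ 2 =
      v 0 ^ 2 + v 1 ^ 2 + v 2 ^ 2 := by
    intro v
    obtain ⟨h0, h1, h2⟩ := hol_apply hα s v
    rw [h0, h1, h2]
    linear_combination (v 1 ^ 2 + v 2 ^ 2) * Real.cos_sq_add_sin_sq (α / (2 * Real.pi) * s)
  have h1 := hnorm w
  have h2 := hnorm (w + c • m)
  rw [map_add, map_smul, hm, hw] at h2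
  rw [hw] at h1
  simp only [PiLp.add_apply, PiLp.smul_apply, smul_eq_mul] at h1 h2
  have h3 : c ^ 2 * (m 0 ^ 2 + m 1 ^ 2 + m 2 ^ 2) = 0 := by linarith
  have h4 : m 0 ^ 2 + m 1 ^ 2 + m 2 ^ 2 = 0 := (mul_eq_zero.1 h3).resolve_left (pow_ne_zero 2 hc)
  ext i
  have := sq_nonneg (m 0)
  have := sq_nonneg (m 1)
  have := sq_nonneg (m 2)
  fin_cases i <;> simp <;> nlinarith

/-- A null vector spanning the axis of the parabolic isometries `hol 0 s`. -/
noncomputable def nullVec : E3 := !₂[1, -1, 0]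

@[simp] lemma nullVec_zero : nullVec 0 = 1 := rfl
@[simp] lemma nullVec_one : nullVec 1 = -1 := rfl
@[simp] lemma nullVec_two : nullVec 2 = 0 := rfl

lemma nullVec_ne_zero : nullVec ≠ 0 := fun h => by
  have := congrArg (fun v : E3 => v 0) h
  simp at this

lemma hol_zero_eq (s : ℝ) (v : E3) :
    hol 0 s v = v + ((s * v 2 + s ^ 2 / 2 * (v 0 + v 1)) • nullVec +
      (s * (v 0 + v 1)) • EuclideanSpace.single 2 1) := by
  obtain ⟨h0, h1, h2⟩ := hol_zero_apply s v
  ext i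
  fin_cases i
  · exact h0.trans (by simp)
  · exact h1.trans (by simp; ring)
  · exact h2.trans (by simp)

lemma hol_zero_nullVec (s : ℝ) : hol 0 s nullVec = nullVec := by
  rw [hol_zero_eq]; simp

lemma hol_zero_single_two (s : ℝ) :
    hol 0 s (EuclideanSpace.single 2 1) = EuclideanSpace.single 2 1 + s • nullVec := by
  rw [hol_zero_eq]; simp

lemma dev_zero_injOn : InjOn (dev 0) {q : E3 | 0 < q 1} := by
  intro p hp q hq h
  have h0 := congrArg (fun v : E3 => v 0) h
  have h1 := congrArg (fun v : E3 => v 1) h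
  have h2 := congrArg (fun v : E3 => v 2) h
  simp only [dev_zero_zero, dev_zero_one, dev_zero_two] at h0 h1 h2
  have e1 : p 1 = q 1 := by linarith
  rw [e1] at h2
  have e2 : p 2 = q 2 := mul_left_cancel₀ (ne_of_gt hq) h2
  have e0 : p 0 = q 0 := by rw [e1, e2] at h0; linarith
  ext i
  fin_cases i
  · exact e0
  · exact e1
  · exact e2

lemma cos_eq_one_of_hol_eq {α s : ℝ} (hα : α ≠ 0) (h : ∀ v, hol α s v = v) :
    Real.cos (α / (2 * Real.pi) * s) = 1 := by
  have := (hol_apply hα s (EuclideanSpace.single 1 1)).2.1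
  rw [h] at this
  simpa using this.symm

/-- If the holonomy is trivial, the developing map is a branched covering of degree at least two. -/
lemma exists_int_of_hol_eq {α : ℝ} (hα : 0 < α) (hα2 : α ≠ 2 * Real.pi)
    (h : ∀ v, hol α (2 * Real.pi) v = v) : ∃ m : ℤ, 2 ≤ m ∧ dev α = cone m := by
  have h1 := cos_eq_one_of_hol_eq hα.ne' h
  have h2 : α / (2 * Real.pi) * (2 * Real.pi) = α := by field_simp
  rw [h2] at h1
  obtain ⟨m, hm, hmα⟩ := exists_int_of_cos_eq_one hα hα2 h1
  exact ⟨m, hm, by rw [dev_of_ne hα.ne', hmα]⟩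

namespace IsLift

variable {α β t ε : ℝ} {φ : E3 → E3} {g : E3 ≃ᵃ[ℝ] E3} {Λ : E3 → E3}

lemma holonomy_linear (hα : 0 ≤ α) (h : IsLift α β φ t ε g Λ) :
    ∃ k : ℤ, (∀ v, g.linear (hol α (2 * Real.pi) v) = hol β (k * (2 * Real.pi)) (g.linear v)) ∧
      hol β (k * (2 * Real.pi)) (g 0) = g 0 := by
  obtain ⟨k, hk⟩ := h.holonomy hα
  have h0 : hol β (k * (2 * Real.pi)) (g 0) = g 0 := by
    rw [← hk, map_zero]
  refine ⟨k, fun v => ?_, h0⟩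
  have := hk v
  rw [minkIsom_apply g v, map_add, h0, minkIsom_apply] at this
  exact add_right_cancel this

/-- A parabolic holonomy is not conjugate to a rotation. -/
lemma false_of_zero_left (hβ : β ≠ 0) (h : IsLift 0 β φ t ε g Λ) : False := by
  obtain ⟨k, hk, -⟩ := h.holonomy_linear le_rfl
  have h1 := hk nullVec
  have h2 := hk (EuclideanSpace.single 2 1)
  rw [hol_zero_nullVec] at h1
  rw [hol_zero_single_two, map_add, map_smul] at h2
  have := eq_zero_of_hol_shear hβ (by positivity : (2 * Real.pi : ℝ) ≠ 0) h1.symm h2.symm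
  exact nullVec_ne_zero ((LinearEquiv.map_eq_zero_iff _).1 this)

/-- A nontrivial rotation is not conjugate to a parabolic isometry; if both are trivial, the
morphism factors through a branched covering, since `𝔼^{1,2}_0` develops injectively. -/
lemma false_of_zero_right (hα : 0 < α) (hα2 : α ≠ 2 * Real.pi) (h : IsLift α 0 φ t ε g Λ)
    (hinj : InjOn φ (polar '' cyl t ε)) : False := by
  obtain ⟨k, hk, -⟩ := h.holonomy_linear hα.le
  have hk0 : k = 0 := by
    by_contra hne
    have h1 := hk (g.linear.symm nullVec)
    have h2 := hk (g.linear.symm (EuclideanSpace.single 2 1))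
    rw [LinearEquiv.apply_symm_apply, hol_zero_nullVec, ← LinearEquiv.eq_symm_apply] at h1
    rw [LinearEquiv.apply_symm_apply, hol_zero_single_two, ← LinearEquiv.eq_symm_apply, map_add,
      map_smul] at h2
    have h3 : (k * (2 * Real.pi) : ℝ) ≠ 0 :=
      mul_ne_zero (Int.cast_ne_zero.2 hne) (by positivity)
    have := eq_zero_of_hol_shear hα.ne' h3 h1 h2
    exact nullVec_ne_zero ((LinearEquiv.map_eq_zero_iff _).1 this)
  have htriv : ∀ v, hol α (2 * Real.pi) v = v := fun v => g.linear.injective (by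
    rw [hk, hk0, hol_zero_eq]; simp)
  obtain ⟨m, hm, hmα⟩ := exists_int_of_hol_eq hα hα2 htriv
  obtain ⟨q, hq⟩ := cyl_nonempty (t := t) h.pos
  refine h.apply_shift_ne hinj (hm.trans (le_abs_self m)) hq (congrArg polar ?_)
  refine dev_zero_injOn (h.pos_one _ (shift_mem_cyl hq)) (h.pos_one q hq) ?_
  rw [h.dev_eq q hq, h.dev_eq _ (shift_mem_cyl hq), hmα, cone_shift (by omega)]

end IsLift

lemma mink_linear {g : E3 ≃ᵃ[ℝ] E3} (hg : g ∈ minkIsom) (v w : E3) :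
    mink (g.linear v) (g.linear w) = mink v w :=
  mink_map_of_minkForm (L := (g.linear : E3 →ₗ[ℝ] E3)) hg.1 v w

/-- An element of `Isom₀` preserving the direction of the time axis is a rotation, up to
translation. -/
lemma exists_rotation_of_linear {g : E3 ≃ᵃ[ℝ] E3} (hg : g ∈ minkIsom)
    (h1 : g.linear (EuclideanSpace.single 0 1) 1 = 0)
    (h2 : g.linear (EuclideanSpace.single 0 1) 2 = 0) :
    ∃ ψ : ℝ, ∀ v, g.linear v 0 = v 0 ∧ g.linear v 1 = Real.cos ψ * v 1 - Real.sin ψ * v 2 ∧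
      g.linear v 2 = Real.sin ψ * v 1 + Real.cos ψ * v 2 := by
  set e : Fin 3 → E3 := fun i => EuclideanSpace.single i 1 with he
  have hpos : 0 < g.linear (e 0) 0 := hg.2.2 _ (by simp [minkForm, he]) (by simp [he])
  have h0 : g.linear (e 0) 0 = 1 := by
    have := hg.1 (e 0)
    simp only [minkForm, he] at this
    rw [h1, h2] at this
    simp at this
    rcases this with h | h
    · exact h
    · simp only [he] at hpos; linarith
  have hv0 : ∀ v, g.linear v 0 = v 0 := fun v => by
    have := mink_linear hg v (e 0)
    simp only [mink, he] at this
    simp only [he] at h0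
    rw [h0, h1, h2] at this
    simpa using this
  set c := g.linear (e 1) 1 with hc
  set s := g.linear (e 1) 2 with hs
  set c' := g.linear (e 2) 1 with hc'
  set s' := g.linear (e 2) 2 with hs'
  have a1 : c ^ 2 + s ^ 2 = 1 := by
    have := hg.1 (e 1)
    simp only [minkForm, hv0] at this
    rw [← hc, ← hs] at this
    simpa [he] using this
  have a2 : c' ^ 2 + s' ^ 2 = 1 := by
    have := hg.1 (e 2)
    simp only [minkForm, hv0] at this
    rw [← hc', ← hs'] at this
    simpa [he] using this
  have a3 : c * c' + s * s' = 0 := by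
    have := mink_linear hg (e 1) (e 2)
    simp only [mink, hv0] at this
    rw [← hc', ← hs', ← hc, ← hs] at this
    simpa [he] using this
  have hM : ∀ v, g.linear v = _ := linear_eq_matCLM (g.linear : E3 →ₗ[ℝ] E3)
  have a4 : 0 < c * s' - s * c' := by
    have hd := hg.2.1
    rw [det_eq_det_of, Matrix.det_fin_three] at hd
    simp only [Matrix.of_apply, LinearEquiv.coe_coe, hv0, h1, h2] at hd
    have hd' : 0 < 1 * c * s' - 1 * c' * s := by simpa [he, hc, hs, hc', hs'] using hd
    linarith
  have a5 : c * s' - s * c' = 1 := by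
    have : (c * s' - s * c') ^ 2 = 1 := by
      linear_combination (c' ^ 2 + s' ^ 2) * a1 + a2 - (c * c' + s * s') * a3
    nlinarith
  have a6 : s' = c := by linear_combination -s' * a1 + c * a5 + s * a3
  have a7 : c' = -s := by linear_combination -c' * a1 - s * a5 + c * a3
  obtain ⟨q, hq1, -, hq⟩ := exists_polar_eq (!₂[0, c, s] : E3)
  have hr : radius (!₂[0, c, s] : E3) = 1 := by
    change √(c ^ 2 + s ^ 2) = 1
    rw [a1, Real.sqrt_one]
  have b1 := congrArg (fun v : E3 => v 1) hq
  have b2 := congrArg (fun v : E3 => v 2) hq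
  simp only [polar_one, polar_two, hq1, hr, one_mul] at b1 b2
  refine ⟨q 2, fun v => ⟨hv0 v, ?_, ?_⟩⟩
  · rw [b1, b2, hM, matCLM_apply]
    change g.linear (e 0) 1 * v 0 + c * v 1 + c' * v 2 = c * v 1 - s * v 2
    rw [h1, a7]; ring
  · rw [b1, b2, hM, matCLM_apply]
    change g.linear (e 0) 2 * v 0 + s * v 1 + s' * v 2 = s * v 1 + c * v 2
    rw [h2, a6]; ring

lemma polar_rotTrans (t₀ θ₀ : ℝ) (q : E3) :
    polar !₂[q 0 + t₀, q 1, q 2 + θ₀] = rotTrans t₀ θ₀ (polar q) := by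
  ext i
  fin_cases i
  · rfl
  · refine (polar_one _).trans ?_
    change q 1 * Real.cos (q 2 + θ₀) = Real.cos θ₀ * polar q 1 - Real.sin θ₀ * polar q 2
    rw [polar_one, polar_two, Real.cos_add]; ring
  · refine (polar_two _).trans ?_
    change q 1 * Real.sin (q 2 + θ₀) = Real.sin θ₀ * polar q 1 + Real.cos θ₀ * polar q 2
    rw [polar_one, polar_two, Real.sin_add]; ring

lemma minkForm_dev_zero (q : E3) : minkForm (dev 0 q) = q 1 ^ 2 - 2 * q 0 * q 1 := by
  rw [minkForm, dev_zero_zero, dev_zero_one, dev_zero_two]; ring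

namespace IsLift

variable {α β t ε : ℝ} {φ : E3 → E3} {g : E3 ≃ᵃ[ℝ] E3} {Λ : E3 → E3}

/-- The conclusion of the local classification. -/
lemma eq_rotTrans (h : IsLift α β φ t ε g Λ) {t₀ θ₀ : ℝ}
    (hΛ : ∀ q ∈ cyl t ε, Λ q 0 = q 0 + t₀ ∧ Λ q 1 = q 1 ∧ Λ q 2 = q 2 + θ₀) :
    ∀ q ∈ cyl t ε, φ (polar q) = rotTrans t₀ θ₀ (polar q) := fun q hq => by
  rw [← h.polar_eq q hq, ← polar_rotTrans]
  congr 1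
  obtain ⟨h0, h1, h2⟩ := hΛ q hq
  ext i
  fin_cases i
  · exact h0
  · exact h1
  · exact h2

/-- If `g` preserves the time axis, then the lift is an affine function of the cylindrical
coordinates, and injectivity fixes the angular coefficient. -/
lemma classify_of_axis (hα : 0 < α) (hβ : 0 < β) (h : IsLift α β φ t ε g Λ)
    (hinj : InjOn φ (polar '' cyl t ε))
    (h1 : g.linear (EuclideanSpace.single 0 1) 1 = 0)
    (h2 : g.linear (EuclideanSpace.single 0 1) 2 = 0) (hb1 : g 0 1 = 0) (hb2 : g 0 2 = 0) :
    α = β ∧ ∃ t₀ θ₀, ∀ q ∈ cyl t ε, φ (polar q) = rotTrans t₀ θ₀ (polar q) := by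
  obtain ⟨ψ, hψ⟩ := exists_rotation_of_linear h.mem h1 h2
  set a := α / (2 * Real.pi) with ha
  set b := β / (2 * Real.pi) with hb
  have ha0 : 0 < a := by positivity
  have hb0 : 0 < b := by positivity
  have key : ∀ q ∈ cyl t ε, Λ q 0 = q 0 + g 0 0 ∧ Λ q 1 = q 1 ∧
      ∃ n : ℤ, b * Λ q 2 - a * q 2 - ψ = n * (2 * Real.pi) := by
    intro q hq
    have hd := h.dev_eq q hq
    rw [dev_of_ne hα.ne', dev_of_ne hβ.ne', ← ha, ← hb, minkIsom_apply] at hd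
    obtain ⟨e0, e1, e2⟩ := hψ (cone a q)
    -- the right hand side is itself given by cylindrical coordinates
    let q' : E3 := !₂[q 0 + g 0 0, q 1, (a * q 2 + ψ) / b]
    have hq' : b * q' 2 = a * q 2 + ψ := mul_div_cancel₀ _ hb0.ne'
    have hd' : cone b (Λ q) = cone b q' := by
      rw [hd]
      ext i
      fin_cases i
      · exact congrArg (· + g 0 0) e0
      · refine Eq.trans (congrArg₂ (· + ·) e1 hb1) ?_
        refine Eq.trans ?_ (cone_one b q').symm
        rw [hq', Real.cos_add]
        simp only [cone_one, cone_two, add_zero]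
        change _ = q 1 * _
        ring
      · refine Eq.trans (congrArg₂ (· + ·) e2 hb2) ?_
        refine Eq.trans ?_ (cone_two b q').symm
        rw [hq', Real.sin_add]
        simp only [cone_one, cone_two, add_zero]
        change _ = q 1 * _
        ring
    obtain ⟨f0, f1, n, hn⟩ := cone_eq_cone (h.pos_one q hq) (show 0 < q' 1 from hq.2.1) hd'
    refine ⟨f0, f1, n, ?_⟩
    rw [← hn, hq']; ring
  obtain ⟨n, hn⟩ := exists_int_mul_of_continuousOn (isConnected_cyl h.pos)
    (f := fun q => b * Λ q 2 - a * q 2 - ψ)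
    (((continuousOn_const.mul ((continuous_coord 2).comp_continuousOn h.continuousOn)).sub
      (continuousOn_const.mul (continuous_coord 2).continuousOn)).sub continuousOn_const)
    (by positivity : (2 * Real.pi : ℝ) ≠ 0) fun q hq => (key q hq).2.2
  have hΛ2 : ∀ q ∈ cyl t ε, Λ q 2 = a / b * q 2 + (ψ + n * (2 * Real.pi)) / b := fun q hq => by
    have := hn q hq
    field_simp
    linarith
  have habs := h.abs_angle_eq_one hinj (c := a / b) (by positivity) fun q hq s => by
    ext i
    fin_cases i
    · exact (key _ (shift_mem_cyl hq)).1.trans (key q hq).1.symm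
    · exact (key _ (shift_mem_cyl hq)).2.1.trans (key q hq).2.1.symm
    · refine (hΛ2 _ (shift_mem_cyl hq)).trans ?_
      change _ = Λ q 2 + _
      rw [hΛ2 q hq, shift_two]; ring
  rw [abs_of_pos (by positivity)] at habs
  have hab : a = b := by rwa [div_eq_one_iff_eq hb0.ne'] at habs
  have hαβ : α = β := by
    rw [ha, hb] at hab
    exact (div_left_inj' (by positivity)).1 hab
  refine ⟨hαβ, g 0 0, (ψ + n * (2 * Real.pi)) / b, h.eq_rotTrans fun q hq => ?_⟩
  refine ⟨(key q hq).1, (key q hq).2.1, ?_⟩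
  rw [hΛ2 q hq, habs, one_mul]

/-- If `g` maps a point of the axis off the axis, then the rotation `hol α` is trivial and the
morphism factors, near this point, through a branched covering. -/
lemma false_of_axis_off (hα : 0 < α) (hα2 : α ≠ 2 * Real.pi) (hβ : 0 < β)
    (h : IsLift α β φ t ε g Λ) (hinj : InjOn φ (polar '' cyl t ε)) {s : ℝ} (hs : |s - t| < ε)
    (hoff : radius (g (EuclideanSpace.single 0 s)) ≠ 0) : False := by
  obtain ⟨k, hk⟩ := h.holonomy hα.le
  set x : E3 := EuclideanSpace.single 0 s with hx
  set y := g x with hy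
  have hxr : radius x = 0 := radius_eq_zero_iff.2 (by simp [hx])
  have hx0 : x 0 = s := by simp [hx]
  have hyr : 0 < y 1 ^ 2 + y 2 ^ 2 := by
    rw [← radius_sq]; positivity
  have hfix : hol α (2 * Real.pi) x = x := by
    obtain ⟨h0, h1, h2⟩ := hol_apply hα.ne' (2 * Real.pi) x
    ext i
    fin_cases i
    · exact h0
    · exact h1.trans (by simp [hx])
    · exact h2.trans (by simp [hx])
  -- a rotation fixing a point off the axis is trivial
  have hβtriv : ∀ v, hol β (k * (2 * Real.pi)) v = v := by
    have hfy : hol β (k * (2 * Real.pi)) y = y := by rw [hy, ← hk, hfix]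
    obtain ⟨-, h1, h2⟩ := hol_apply hβ.ne' (k * (2 * Real.pi)) y
    rw [hfy] at h1 h2
    set c := Real.cos (β / (2 * Real.pi) * (k * (2 * Real.pi))) with hc
    set σ := Real.sin (β / (2 * Real.pi) * (k * (2 * Real.pi))) with hσ
    have hc1 : c = 1 := by
      have : (c - 1) * (y 1 ^ 2 + y 2 ^ 2) = 0 := by linear_combination -y 1 * h1 - y 2 * h2
      linarith [(mul_eq_zero.1 this).resolve_right hyr.ne']
    have hσ0 : σ = 0 := by
      have : σ * (y 1 ^ 2 + y 2 ^ 2) = 0 := by linear_combination y 2 * h1 - y 1 * h2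
      exact (mul_eq_zero.1 this).resolve_right hyr.ne'
    intro v
    obtain ⟨f0, f1, f2⟩ := hol_apply hβ.ne' (k * (2 * Real.pi)) v
    rw [← hc, ← hσ, hc1, hσ0] at f1 f2
    ext i
    fin_cases i
    · exact f0
    · exact f1.trans (by simp)
    · exact f2.trans (by simp)
  have htriv : ∀ v, hol α (2 * Real.pi) v = v := fun v => g.injective (by rw [hk, hβtriv])
  obtain ⟨m, hm, hmα⟩ := exists_int_of_hol_eq hα hα2 htriv
  -- shrink the cylinder, so that `g` maps it to the half space around `y`
  have hO : ∀ᶠ v in 𝓝 x, 0 < g v 1 * y 1 + g v 2 * y 2 := by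
    have hcg := continuous_affineEquiv g
    have hcont : Continuous fun v => g v 1 * y 1 + g v 2 * y 2 :=
      (((continuous_coord 1).comp hcg).mul continuous_const).add
        (((continuous_coord 2).comp hcg).mul continuous_const)
    refine hcont.continuousAt.eventually (lt_mem_nhds ?_)
    change 0 < g x 1 * y 1 + g x 2 * y 2
    rw [← hy]; linarith
  obtain ⟨δ, hδ, hδO⟩ := exists_cylinder_subset hxr hO
  set ε' := min δ (ε - |s - t|) with hε'
  have hε'0 : 0 < ε' := lt_min hδ (sub_pos.2 hs)
  have hsub : cyl s ε' ⊆ cyl t ε := by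
    rintro q ⟨h0, h1, h2⟩
    have h3 : ε' ≤ ε - |s - t| := min_le_right _ _
    refine ⟨?_, h1, ?_⟩
    · have := abs_sub_le (q 0) s t
      linarith
    · have := abs_nonneg (s - t)
      linarith
  set b := β / (2 * Real.pi) with hb
  have hb0 : 0 < b := by positivity
  have hhalf : ∀ q ∈ cyl s ε', 0 < Real.cos (b * Λ q 2) * y 1 + Real.sin (b * Λ q 2) * y 2 := by
    intro q hq
    have h1 : dev α q ∈ {p : E3 | |p 0 - x 0| < δ ∧ radius p < δ} := by
      rw [hmα, hx0]
      refine ⟨hq.1.trans_le (min_le_left _ _), ?_⟩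
      rw [radius_cone _ hq.2.1.le]
      exact hq.2.2.trans_le (min_le_left _ _)
    have h2 := hδO h1
    rw [mem_ofPred_eq, ← h.dev_eq q (hsub hq), dev_of_ne hβ.ne', ← hb, cone_one, cone_two] at h2
    have h3 : 0 < Λ q 1 * (Real.cos (b * Λ q 2) * y 1 + Real.sin (b * Λ q 2) * y 2) := by
      linarith
    exact pos_of_mul_pos_right h3 (h.pos_one q (hsub hq)).le
  -- so the developed angle varies by less than half a turn on the cylinder
  have hlt : ∀ p ∈ cyl s ε', ∀ q ∈ cyl s ε', b * Λ p 2 < b * Λ q 2 + Real.pi := by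
    intro p hp q hq
    by_contra! hge
    have hJ : IsPreconnected ((fun q => b * Λ q 2) '' cyl s ε') :=
      (isConnected_cyl hε'0).isPreconnected.image _ (continuousOn_const.mul
        ((continuous_coord 2).comp_continuousOn (h.continuousOn.mono hsub)))
    obtain ⟨z, hz, hzeq⟩ := hJ.ordConnected.out (mem_image_of_mem _ hq) (mem_image_of_mem _ hp)
      ⟨le_add_of_nonneg_right Real.pi_pos.le, hge⟩
    have h1 := hhalf z hz
    have h2 := hhalf q hq
    simp only at hzeq
    rw [hzeq, Real.cos_add_pi, Real.sin_add_pi] at h1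
    linarith
  obtain ⟨q, hq⟩ := cyl_nonempty (t := s) hε'0
  have hq' : shift (2 * Real.pi / m) q ∈ cyl s ε' := shift_mem_cyl hq
  refine h.apply_shift_ne hinj (hm.trans (le_abs_self m)) (hsub hq) (congrArg polar ?_)
  have heq : cone b (Λ (shift (2 * Real.pi / m) q)) = cone b (Λ q) := by
    rw [hb, ← dev_of_ne hβ.ne', h.dev_eq q (hsub hq), h.dev_eq _ (hsub hq'), hmα,
      cone_shift (by omega)]
  obtain ⟨e0, e1, n, hn⟩ := cone_eq_cone (h.pos_one _ (hsub hq')) (h.pos_one q (hsub hq)) heq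
  have hn0 : n = 0 := by
    have l1 := hlt _ hq' _ hq
    have l2 := hlt _ hq _ hq'
    have hpi := Real.pi_pos
    have l3 : (n : ℝ) < 1 := by nlinarith
    have l4 : (-1 : ℝ) < n := by nlinarith
    have l5 : n < 1 := by exact_mod_cast l3
    have l6 : -1 < n := by exact_mod_cast l4
    omega
  rw [hn0, Int.cast_zero, zero_mul, sub_eq_zero] at hn
  ext i
  fin_cases i
  · exact e0
  · exact e1
  · exact mul_left_cancel₀ hb0.ne' hn

lemma classify_of_pos (hα : 0 < α) (hα2 : α ≠ 2 * Real.pi) (hβ : 0 < β)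
    (h : IsLift α β φ t ε g Λ) (hinj : InjOn φ (polar '' cyl t ε)) :
    α = β ∧ ∃ t₀ θ₀, ∀ q ∈ cyl t ε, φ (polar q) = rotTrans t₀ θ₀ (polar q) := by
  have hax : ∀ s, |s - t| < ε → g (EuclideanSpace.single 0 s) 1 = 0 ∧
      g (EuclideanSpace.single 0 s) 2 = 0 := fun s hs => by
    rw [← radius_eq_zero_iff]
    by_contra hoff
    exact h.false_of_axis_off hα hα2 hβ hinj hs hoff
  have hlin : ∀ s : ℝ, ∀ i, g (EuclideanSpace.single 0 s) i =
      s * g.linear (EuclideanSpace.single 0 1) i + g 0 i := fun s i => by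
    have : (EuclideanSpace.single 0 s : E3) = s • EuclideanSpace.single 0 1 := by
      ext j; fin_cases j <;> simp
    rw [this, minkIsom_apply, map_smul]; rfl
  have ε0 := h.pos
  have ht := hax t (by simpa using ε0)
  have ht' := hax (t + ε / 2) (by rw [add_sub_cancel_left, abs_of_pos] <;> linarith)
  rw [hlin, hlin] at ht ht'
  have e1 : g.linear (EuclideanSpace.single 0 1) 1 = 0 := by
    have : ε / 2 * g.linear (EuclideanSpace.single 0 1) 1 = 0 := by linarith [ht.1, ht'.1]
    exact (mul_eq_zero.1 this).resolve_left (by positivity)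
  have e2 : g.linear (EuclideanSpace.single 0 1) 2 = 0 := by
    have : ε / 2 * g.linear (EuclideanSpace.single 0 1) 2 = 0 := by linarith [ht.2, ht'.2]
    exact (mul_eq_zero.1 this).resolve_left (by positivity)
  rw [e1, e2, mul_zero, zero_add, zero_add] at ht
  exact h.classify_of_axis hα hβ hinj e1 e2 ht.1 ht.2

/-- For `α = β = 0` the map `g` normalizes the parabolic holonomy, hence scales its null axis by
some `μ > 0`. The lift multiplies the angle by `± μ`, so that injectivity forces `μ = 1`. -/
lemma classify_of_zero (h : IsLift 0 0 φ t ε g Λ) (hinj : InjOn φ (polar '' cyl t ε)) :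
    ∃ t₀ θ₀, ∀ q ∈ cyl t ε, φ (polar q) = rotTrans t₀ θ₀ (polar q) := by
  obtain ⟨k, hk, hb⟩ := h.holonomy_linear le_rfl
  have hg := h.mem
  set L := g.linear with hL
  set e : Fin 3 → E3 := fun i => EuclideanSpace.single i 1 with he
  have hpi := Real.pi_pos
  have hw : ∀ v, mink v nullVec = -(v 0 + v 1) := fun v => by simp [mink]; ring
  obtain ⟨μ, hμ⟩ : ∃ μ : ℝ, L nullVec = μ • nullVec := by
    have h1 := hk (e 2)
    rw [he, hol_zero_single_two, map_add, map_smul, hol_zero_eq] at h1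
    have h2 := add_left_cancel h1
    have h3 := congrArg (fun v : E3 => v 0) h2
    have h4 := congrArg (fun v : E3 => v 1) h2
    simp at h3 h4
    have h5 : L nullVec 1 = -L nullVec 0 := by
      have : 2 * Real.pi * (L nullVec 1 + L nullVec 0) = 0 := by linarith
      linarith [(mul_eq_zero.1 this).resolve_left (by positivity)]
    have h6 := hg.1 nullVec
    rw [← hL] at h6
    simp only [minkForm, h5, nullVec_zero, nullVec_one, nullVec_two] at h6
    have h7 : L nullVec 2 = 0 := by
      have : L nullVec 2 ^ 2 = 0 := by linarith
      exact pow_eq_zero_iff two_ne_zero |>.1 this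
    refine ⟨L nullVec 0, ?_⟩
    ext i
    fin_cases i
    · simp
    · simpa using h5
    · simpa using h7
  have hwL : ∀ v, μ * (L v 0 + L v 1) = v 0 + v 1 := fun v => by
    have h1 := mink_linear hg v nullVec
    rw [← hL, hμ, hw] at h1
    simp [mink] at h1
    linarith
  have hμpos : 0 < μ := by
    have h1 := hwL (e 0)
    have h2 : 0 < L (e 0) 0 := hg.2.2 _ (by simp [minkForm, he]) (by simp [he])
    have h3 := hg.1 (e 0)
    rw [← hL] at h3
    simp [minkForm, he] at h1 h2 h3
    have h4 : 0 < L (EuclideanSpace.single 0 1) 0 + L (EuclideanSpace.single 0 1) 1 := by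
      nlinarith [sq_nonneg (L (EuclideanSpace.single 0 1) 2)]
    by_contra! hneg
    nlinarith
  -- the translation part of `g` is along the null axis
  have hk0 : (k * (2 * Real.pi) : ℝ) ≠ 0 := by
    intro h0
    have h1 := hk (e 2)
    rw [h0, he, hol_zero_single_two, hol_zero_eq] at h1
    simp at h1
    exact nullVec_ne_zero h1
  have hb' : g 0 0 + g 0 1 = 0 ∧ g 0 2 = 0 := by
    rw [hol_zero_eq] at hb
    have h1 := add_eq_left.1 hb
    have h2 := congrArg (fun v : E3 => v 2) h1
    have h3 := congrArg (fun v : E3 => v 0) h1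
    simp only [PiLp.add_apply, PiLp.smul_apply, nullVec_two, nullVec_zero, smul_eq_mul, mul_zero,
      zero_add, PiLp.zero_apply, mul_one] at h2 h3
    simp at h2 h3
    have h4 : g 0 0 + g 0 1 = 0 := by
      rcases h2 with h | h
      · exact absurd h (by simpa [hpi.ne'] using hk0)
      · exact h
    rw [h4, mul_zero, add_zero] at h3
    exact ⟨h4, (mul_eq_zero.1 h3).resolve_left hk0⟩
  -- the transverse coordinate
  set a := L (e 2) 2 with ha
  set c := L (e 0) 2 with hc
  have hL2 : ∀ v, L v 2 = c * (v 0 + v 1) + a * v 2 := fun v => by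
    have hv : v = (v 0 + v 1) • e 0 + (-v 1) • nullVec + v 2 • e 2 := by
      ext i; fin_cases i <;> simp [he]
    conv_lhs => rw [hv]
    rw [map_add, map_add, map_smul, map_smul, map_smul, hμ]
    simp [← ha, ← hc]; ring
  have he2 : L (e 2) 0 + L (e 2) 1 = 0 := by
    have := hwL (e 2)
    simp only [he] at this ⊢
    simpa [hμpos.ne'] using this
  have ha2 : a ^ 2 = 1 := by
    have h1 := hg.1 (e 2)
    rw [← hL, minkForm, ← ha] at h1
    have h2 : minkForm (e 2) = 1 := by simp [minkForm, he]
    rw [h2] at h1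
    linear_combination h1 + (L (e 2) 0 - L (e 2) 1) * he2
  have key : ∀ q ∈ cyl t ε, Λ q 1 = q 1 / μ ∧ Λ q 2 = μ * (c + a * q 2) ∧
      Λ q 0 = q 1 / μ / 2 + μ * (2 * q 0 - q 1) / 2 + g 0 0 := by
    intro q hq
    have hq1 : 0 < q 1 := hq.2.1
    have hd := h.dev_eq q hq
    rw [minkIsom_apply, ← hL] at hd
    have d0 := congrArg (fun v : E3 => v 0) hd
    have d1 := congrArg (fun v : E3 => v 1) hd
    have d2 := congrArg (fun v : E3 => v 2) hd
    simp only [PiLp.add_apply, dev_zero_zero, dev_zero_one, dev_zero_two] at d0 d1 d2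
    have h1 := hwL (dev 0 q)
    have h2 := hL2 (dev 0 q)
    simp only [dev_zero_zero, dev_zero_one, dev_zero_two] at h1 h2
    have h3 : Λ q 1 = q 1 / μ := by
      rw [eq_div_iff hμpos.ne']
      linear_combination μ * d0 + μ * d1 + h1 + μ * hb'.1
    have h4 : Λ q 2 = μ * (c + a * q 2) := by
      rw [h2, hb'.2, h3] at d2
      field_simp at d2
      have h5 : 2 * q 1 * (Λ q 2 - μ * (c + a * q 2)) = 0 := by linear_combination d2
      exact sub_eq_zero.1 ((mul_eq_zero.1 h5).resolve_left (by positivity))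
    refine ⟨h3, h4, ?_⟩
    have h5 := minkForm_dev_zero (Λ q)
    have hg0 : g 0 = (g 0 0) • nullVec := by
      ext i
      fin_cases i
      · simp
      · simp; linarith [hb'.1]
      · simpa using hb'.2
    have h6 : mink (L (dev 0 q)) (g 0) = -(g 0 0) * (q 1 / μ) := by
      have h7 := hw (L (dev 0 q))
      have h8 : L (dev 0 q) 0 + L (dev 0 q) 1 = q 1 / μ := by
        rw [eq_div_iff hμpos.ne']; linear_combination h1
      rw [h8] at h7
      rw [hg0]
      simp only [mink, PiLp.smul_apply, smul_eq_mul] at h7 ⊢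
      simp only [nullVec_zero, nullVec_one, nullVec_two] at h7 ⊢
      linear_combination g 0 0 * h7
    have h7 : minkForm (g 0) = 0 := by
      simp only [minkForm, hb'.2]
      linear_combination (g 0 1 - g 0 0) * hb'.1
    have h8 : minkForm (L (dev 0 q)) = _ := (hg.1 _).trans (minkForm_dev_zero q)
    rw [hd, minkForm_add, h6, h7, h8, h3] at h5
    field_simp at h5 ⊢
    refine mul_left_cancel₀ hq1.ne' ?_
    linear_combination h5
  have habs := h.abs_angle_eq_one hinj (c := μ * a)
    (mul_ne_zero hμpos.ne' (by rintro h0; rw [h0] at ha2; norm_num at ha2)) fun q hq s => by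
      obtain ⟨k1, k2, k0⟩ := key q hq
      obtain ⟨l1, l2, l0⟩ := key _ (shift_mem_cyl (s := s) hq)
      ext i
      fin_cases i
      · exact l0.trans k0.symm
      · exact l1.trans k1.symm
      · refine l2.trans ?_
        change _ = Λ q 2 + _
        rw [k2, shift_two]; ring
  have ha1 : |a| = 1 := by
    rw [← sq_eq_sq₀ (abs_nonneg a) zero_le_one, sq_abs, ha2, one_pow]
  have hμ1 : μ = 1 := by
    rwa [abs_mul, abs_of_pos hμpos, ha1, mul_one] at habs
  subst hμ1
  -- `a` is the determinant of `g`
  have hda : 0 < a := by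
    have hd := hg.2.1
    rw [det_eq_det_of, Matrix.det_fin_three] at hd
    have hL1 : ∀ i, L (e 1) i = L (e 0) i - nullVec i := fun i => by
      have : e 1 = e 0 - nullVec := by
        ext j; fin_cases j <;> simp [he]
      rw [this, map_sub, hμ, one_smul]; rfl
    have hL0 := hwL (e 0)
    have he0 : e 0 0 + e 0 1 = 1 := by simp [he]
    rw [he0, one_mul] at hL0
    change 0 < L (e 0) 0 * L (e 1) 1 * L (e 2) 2 - L (e 0) 0 * L (e 2) 1 * L (e 1) 2 -
      L (e 1) 0 * L (e 0) 1 * L (e 2) 2 + L (e 1) 0 * L (e 2) 1 * L (e 0) 2 +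
      L (e 2) 0 * L (e 0) 1 * L (e 1) 2 - L (e 2) 0 * L (e 1) 1 * L (e 0) 2 at hd
    simp only [hL1, nullVec_zero, nullVec_one, nullVec_two, ← ha, ← hc, sub_zero] at hd
    linarith [mul_eq_zero_of_right c he2, mul_eq_zero_of_right (a - 1) (sub_eq_zero.2 hL0)]
  have ha1' : a = 1 := by rwa [abs_of_pos hda] at ha1
  refine ⟨g 0 0, c, h.eq_rotTrans fun q hq => ?_⟩
  obtain ⟨k1, k2, k0⟩ := key q hq
  rw [k0, k1, k2, ha1']
  refine ⟨?_, ?_, ?_⟩ <;> ring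

end IsLift

/-- Injective morphisms are rotations-translations near each point of the axis. -/
lemma exists_eq_rotTrans_near_axis {α β : ℝ} (hα : 0 ≤ α) (hβ : 0 ≤ β) (hα2 : α ≠ 2 * Real.pi)
    {U : Set E3} {x : E3} (hU : U ∈ 𝓝 x) (hx : radius x = 0) {φ : E3 → E3}
    (hφ : IsMorphismOn (modelAtlas α) (modelAtlas β) φ (U ∩ offAxis))
    (hinj : InjOn φ (U ∩ offAxis)) :
    α = β ∧ ∃ ε > 0, ∃ t₀ θ₀, ∀ q ∈ cyl (x 0) ε,
      polar q ∈ U ∩ offAxis ∧ φ (polar q) = rotTrans t₀ θ₀ (polar q) := by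
  have hβ2 : β ≠ 2 * Real.pi := by
    rintro rfl
    refine not_injOn_of_eventuallyEq_dev hα hα2 hU hx (ψ := φ) (fun q hq hqU => ?_) hinj
    obtain ⟨c, hc, hqc, H⟩ := exists_modelAtlas_dev hα hq
    have hm := hφ (polar q) ⟨hqU, show 0 < radius _ by rwa [radius_polar hq.le]⟩
    obtain ⟨g, hg, h⟩ := hm.exists_eq (isAEStructure_modelAtlas hα) (isAEStructure_modelAtlas hβ)
      hm.continuousAt ((isAEStructure_modelAtlas hα).subset_regAtlas hc) hqc
      refl_mem_regAtlas_two_pi (mem_univ _)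
    refine ⟨g, hg, ?_⟩
    filter_upwards [H, contDiff_polar.continuous.continuousAt.eventually h] with y h1 h2
    rw [← h1, ← h2.2]; rfl
  obtain ⟨ε, hε, hεU⟩ := exists_cylinder_subset hx hU
  have hcyl : ∀ q ∈ cyl (x 0) ε, polar q ∈ U ∩ offAxis := fun q hq => by
    have := mem_image_of_mem polar hq
    rw [polar_image_cyl] at this
    exact ⟨hεU this.1, this.2⟩
  obtain ⟨g, Λ, h⟩ := exists_isLift hα hβ hε (fun q hq => hφ _ (hcyl q hq)) fun q hq => by
    rw [← Reg_modelAtlas hβ hβ2]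
    exact (hφ _ (hcyl q hq)).mem_Reg.2
  have hinj' : InjOn φ (polar '' cyl (x 0) ε) := hinj.mono (image_subset_iff.2 hcyl)
  have key : α = β ∧ ∃ t₀ θ₀, ∀ q ∈ cyl (x 0) ε, φ (polar q) = rotTrans t₀ θ₀ (polar q) := by
    rcases hα.eq_or_lt with rfl | hα0
    · rcases hβ.eq_or_lt with rfl | hβ0
      · exact ⟨rfl, h.classify_of_zero hinj'⟩
      · exact (h.false_of_zero_left hβ0.ne').elim
    · rcases hβ.eq_or_lt with rfl | hβ0
      · exact (h.false_of_zero_right hα0 hα2 hinj').elim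
      · exact h.classify_of_pos hα0 hα2 hβ0 hinj'
  obtain ⟨hαβ, t₀, θ₀, H⟩ := key
  exact ⟨hαβ, ε, hε, t₀, θ₀, fun q hq => ⟨hcyl q hq, H q hq⟩⟩

/-! ### Rotations-translations are morphisms -/

lemma det_holMat (α s : ℝ) : (holMat α s).det = 1 := by
  rw [holMat, Matrix.det_fin_three]
  split_ifs
  · simp; ring
  · simp [← sq]

lemma minkForm_hol (α s : ℝ) (v : E3) : minkForm (hol α s v) = minkForm v := by
  by_cases hα : α = 0
  · subst hα
    obtain ⟨h0, h1, h2⟩ := hol_zero_apply s v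
    rw [minkForm, minkForm, h0, h1, h2]; ring
  · obtain ⟨h0, h1, h2⟩ := hol_apply hα s v
    rw [minkForm, minkForm, h0, h1, h2]
    linear_combination (v 1 ^ 2 + v 2 ^ 2) * Real.cos_sq_add_sin_sq (α / (2 * Real.pi) * s)

lemma hol_future (α s : ℝ) {v : E3} (hv : minkForm v < 0) (h0 : 0 < v 0) : 0 < hol α s v 0 := by
  by_cases hα : α = 0
  · subst hα
    rw [(hol_zero_apply s v).1]
    rw [minkForm] at hv
    have hw : 0 < v 0 + v 1 := by
      by_contra! hneg
      nlinarith [sq_nonneg (v 2)]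
    have : 0 < 2 * (v 0 + v 1) * (v 0 + (s * v 2 + s ^ 2 / 2 * (v 0 + v 1))) := by
      nlinarith [sq_nonneg (s * (v 0 + v 1) + v 2), sq_nonneg (v 0 + v 1)]
    exact pos_of_mul_pos_right this (by positivity)
  · rwa [(hol_apply hα s v).1]

/-- In the developing map, a rotation-translation is an element of `Isom₀`. -/
lemma exists_minkIsom_dev_add (α t₀ s : ℝ) :
    ∃ g ∈ minkIsom, ∀ y : E3, dev α !₂[y 0 + t₀, y 1, y 2 + s] = g (dev α y) := by
  have hdet : LinearMap.det (hol α s : E3 →ₗ[ℝ] E3) = 1 := by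
    have := matCLM_det (holMat α s)
    rwa [det_holMat] at this
  let L : E3 ≃ₗ[ℝ] E3 := LinearMap.equivOfDetNeZero (hol α s : E3 →ₗ[ℝ] E3)
    (by rw [hdet]; exact one_ne_zero)
  let u : E3 := if α = 0 then nullVec else EuclideanSpace.single 0 1
  refine ⟨L.toAffineEquiv.trans (AffineEquiv.constVAdd ℝ E3 (t₀ • u)),
    ⟨minkForm_hol α s, ?_, fun v hv h0 => hol_future α s hv h0⟩, fun y => ?_⟩
  · exact zero_lt_one.trans_eq hdet.symm
  · change _ = t₀ • u + hol α s (dev α y)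
    rw [← dev_shift]
    by_cases hα : α = 0
    · subst hα
      simp only [u, if_true]
      ext i
      fin_cases i
      · simp [dev]; ring
      · simp [dev]; ring
      · simp [dev]
    · simp only [u, if_neg hα, dev_of_ne hα]
      ext i
      fin_cases i
      · simp [cone]; ring
      · simp [cone]
      · simp [cone]

lemma contDiff_rotTrans (t₀ θ₀ : ℝ) : ContDiff ℝ ∞ (rotTrans t₀ θ₀) := by
  have h : ∀ j : Fin 3, ContDiff ℝ ∞ fun y : E3 => y j := fun j =>
    (EuclideanSpace.proj j : E3 →L[ℝ] ℝ).contDiff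
  rw [contDiff_euclidean]
  intro i
  fin_cases i
  · exact (h 0).add contDiff_const
  · exact (contDiff_const.mul (h 1)).sub (contDiff_const.mul (h 2))
  · exact (contDiff_const.mul (h 1)).add (contDiff_const.mul (h 2))

lemma isMorphismAt_rotTrans {α : ℝ} (hα : 0 ≤ α) (t₀ θ₀ : ℝ) {p : E3} (hp : p ∈ offAxis) :
    IsMorphismAt (modelAtlas α) (modelAtlas α) (rotTrans t₀ θ₀) p := by
  obtain ⟨q, hq, -, rfl⟩ := exists_polar_eq p
  have hq0 : 0 < q 1 := hq ▸ hp
  set T : E3 → E3 := fun y => !₂[y 0 + t₀, y 1, y 2 + θ₀] with hT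
  have hTc : Continuous T := by
    refine (PiLp.continuous_toLp 2 _).comp (continuous_pi fun i => ?_)
    fin_cases i
    · exact (continuous_coord 0).add continuous_const
    · exact continuous_coord 1
    · exact (continuous_coord 2).add continuous_const
  obtain ⟨c, hc, hqc, H⟩ := exists_modelAtlas_dev hα hq0
  obtain ⟨c', hc', hqc', H'⟩ := exists_modelAtlas_dev hα (q := T q) hq0
  obtain ⟨g, hg, hgT⟩ := exists_minkIsom_dev_add α t₀ θ₀
  have hsub := (isAEStructure_modelAtlas hα).subset_regAtlas
  refine ⟨c, hsub hc, c', hsub hc', hqc, g, hg, ?_⟩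
  rw [← map_nhds_polar hq0, eventually_map]
  filter_upwards [H, hTc.continuousAt.eventually H', (contDiff_polar.continuous.comp
    hTc).continuousAt.eventually (c'.open_source.mem_nhds hqc')] with y h1 h2 h3
  rw [← polar_rotTrans, h1, ← hgT]
  exact ⟨h3, h2⟩

/-! ### Rigidity of morphisms between the model spaces -/

/-- A morphism which is injective near a point of the axis is a rotation-translation, by the local
classification and unique continuation. -/
lemma exists_eqOn_modelIsom {α β : ℝ} (hα : 0 ≤ α) (hβ : 0 ≤ β) (hα2 : α ≠ 2 * Real.pi)
    {U : Set E3} (hU : IsOpen U) (hUc : IsConnected U) {V : Set E3} {x : E3} (hV : V ∈ 𝓝 x)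
    (hVU : V ⊆ U) (hx : radius x = 0) {φ : E3 → E3}
    (hφ : IsMorphismOn (modelAtlas α) (modelAtlas β) φ (U ∩ offAxis))
    (hinj : InjOn φ (V ∩ offAxis)) :
    α = β ∧ ∃ ψ ∈ modelIsom, EqOn φ ψ (U ∩ offAxis) := by
  obtain ⟨rfl, ε, hε, t₀, θ₀, H⟩ := exists_eq_rotTrans_near_axis hα hβ hα2 hV hx
    (fun p hp => hφ p ⟨hVU hp.1, hp.2⟩) hinj
  refine ⟨rfl, _, ⟨t₀, θ₀, rfl⟩, ?_⟩
  obtain ⟨q, hq⟩ := cyl_nonempty (t := x 0) hε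
  have hA := isAEStructure_modelAtlas hα
  refine IsMorphismOn.eqOn_of_eventuallyEq hA hA
    (locallyConnectedIn_offAxis U (subset_univ _) hU hUc).isPreconnected hφ
    (fun p hp => isMorphismAt_rotTrans hα t₀ θ₀ hp.2) (x₀ := polar q)
    ⟨hVU (H q hq).1.1, (H q hq).1.2⟩ ?_
  rw [EventuallyEq, ← map_nhds_polar hq.2.1, eventually_map]
  filter_upwards [(isOpen_cyl _ _).mem_nhds hq] with y hy using (H y hy).2

/-- The version of the rigidity for almost everywhere morphisms which are local homeomorphisms:
these map regular points to regular points, and so are morphisms off the axis. -/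
lemma exists_eqOn_modelIsom_of_isLocalHomeomorphOn {α β : ℝ} (hα : 0 ≤ α) (hβ : 0 ≤ β)
    (hα2 : α ≠ 2 * Real.pi) {U : Set E3} (hU : IsOpen U) (hUc : IsConnected U) {x : E3}
    (hxU : x ∈ U) (hx : radius x = 0) {φ : E3 → E3}
    (hφ : IsAEMorphismOn (modelAtlas α) (modelAtlas β) φ U) (hloc : IsLocalHomeomorphOn φ U) :
    α = β ∧ ∃ ψ ∈ modelIsom, EqOn φ ψ U := by
  have hA := isAEStructure_modelAtlas hα
  have hB := isAEStructure_modelAtlas hβ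
  have hm : IsMorphismOn (modelAtlas α) (modelAtlas β) φ (U ∩ offAxis) := by
    rintro p ⟨hpU, hp⟩
    obtain ⟨e, hpe, rfl⟩ := hloc p hpU
    have hpA := offAxis_subset_Reg hα hp
    refine hφ.isMorphismAt hA hB hU hpU hpA ?_
    exact (IsAEMorphismOn.mem_Reg_iff hA hB (f := e.restrOpen U hU)
      (hφ.mono (e.restrOpen U hU).open_source fun y hy => hy.2) ⟨hpe, hpU⟩).1 hpA
  obtain ⟨e, hxe, he⟩ := hloc x hxU
  obtain ⟨hαβ, ψ, hψ, H⟩ := exists_eqOn_modelIsom hα hβ hα2 hU hUc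
    (inter_mem (e.open_source.mem_nhds hxe) (hU.mem_nhds hxU)) inter_subset_right hx hm
    (he ▸ e.injOn.mono fun y hy => hy.1.1)
  refine ⟨hαβ, ψ, hψ, H.of_subset_closure hφ.1 ?_ inter_subset_left
    (dense_offAxis.open_subset_closure_inter hU)⟩
  obtain ⟨t₀, θ₀, rfl⟩ := hψ
  exact (contDiff_rotTrans t₀ θ₀).continuous.continuousOn

/-! ### Charts of singular manifolds -/

/-- Around each regular point of a model space there is a regular chart which is smooth for the
standard structure of `ℝ³`. -/
lemma exists_regAtlas_contDiffAt {α : ℝ} (hα : 0 ≤ α) {p : E3} (hp : p ∈ Reg (modelAtlas α)) :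
    ∃ c ∈ regAtlas (modelAtlas α), p ∈ c.source ∧ ContDiffAt ℝ ∞ c p ∧
      ContDiffAt ℝ ∞ c.symm (c p) := by
  by_cases hα2 : α = 2 * Real.pi
  · subst hα2
    exact ⟨_, refl_mem_regAtlas_two_pi, mem_univ _, contDiffAt_id, contDiffAt_id⟩
  · rw [Reg_modelAtlas hα hα2, ← biUnion_modelAtlas hα] at hp
    simp only [mem_iUnion] at hp
    obtain ⟨c, hc, hpc⟩ := hp
    exact ⟨c, (isAEStructure_modelAtlas hα).subset_regAtlas hc, hpc, modelAtlas_contDiffAt hc hpc,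
      modelAtlas_contDiffAt_symm hc hpc⟩

lemma IsMorphismAt.contDiffAt {α β : ℝ} (hα : 0 ≤ α) (hβ : 0 ≤ β) {φ : E3 → E3} {p : E3}
    (h : IsMorphismAt (modelAtlas α) (modelAtlas β) φ p) : ContDiffAt ℝ ∞ φ p := by
  obtain ⟨c, hc, hpc, hs, -⟩ := exists_regAtlas_contDiffAt hα h.mem_Reg.1
  obtain ⟨c', hc', hpc', -, hs'⟩ := exists_regAtlas_contDiffAt hβ h.mem_Reg.2
  obtain ⟨g, hg, H⟩ := h.exists_eq (isAEStructure_modelAtlas hα) (isAEStructure_modelAtlas hβ)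
    h.continuousAt hc hpc hc' hpc'
  rw [H.self_of_nhds.2] at hs'
  have h1 : ContDiffAt ℝ ∞ (fun y => c'.symm (g (c y))) p :=
    ContDiffAt.comp (f := fun y => g (c y)) p hs' ((contDiff_affineEquiv g).contDiffAt.comp p hs)
  refine h1.congr_of_eventuallyEq (H.mono fun y hy => ?_)
  change φ y = c'.symm (g (c y))
  rw [← hy.2, c'.left_inv hy.1]

section Types

variable {M : Type*} [TopologicalSpace M] {A : Set (OpenPartialHomeomorph M E3)}

lemma IsModelChart.mem_Sing_iff (hA : IsAEStructure A) {α : ℝ} (hα : 0 ≤ α)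
    {f : OpenPartialHomeomorph M E3} (hf : IsModelChart A α f) {p : M} (hp : p ∈ f.source) :
    p ∈ Sing A ↔ f p ∈ Sing (modelAtlas α) :=
  (IsAEMorphismOn.mem_Reg_iff hA (isAEStructure_modelAtlas hα) hf hp).not

/-- In a model chart around a singular point, the singular locus is the axis. -/
lemma IsModelChart.mem_Sing_iff_coord (hA : IsAEStructure A) {α : ℝ} (hα : 0 ≤ α)
    {f : OpenPartialHomeomorph M E3} (hf : IsModelChart A α f) {p : M} (hp : p ∈ f.source)
    (hpS : p ∈ Sing A) {q : M} (hq : q ∈ f.source) : q ∈ Sing A ↔ f q 1 = 0 ∧ f q 2 = 0 := by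
  have hα2 := ne_two_pi_of_mem_Sing ((hf.mem_Sing_iff hA hα hp).1 hpS)
  rw [hf.mem_Sing_iff hA hα hq, mem_Sing_modelAtlas hα hα2, radius_eq_zero_iff]

lemma IsModelChart.isAEMorphismOn_transition (hA : IsAEStructure A) {α β : ℝ}
    {f f' : OpenPartialHomeomorph M E3} (hf : IsModelChart A α f) (hf' : IsModelChart A β f') :
    IsAEMorphismOn (modelAtlas α) (modelAtlas β) (f.symm.trans f') (f.symm.trans f').source :=
  IsAEMorphismOn.trans hA (IsAEMorphismOn.symm hA hf) hf'

/-- Near a singular point, changes of model charts are rotations-translations. -/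
lemma IsModelChart.transition_eq (hA : IsAEStructure A) {α β : ℝ} (hα : 0 ≤ α) (hβ : 0 ≤ β)
    {f f' : OpenPartialHomeomorph M E3} (hf : IsModelChart A α f) (hf' : IsModelChart A β f')
    {y : E3} (hy : y ∈ (f.symm.trans f').source) (hyS : y ∈ Sing (modelAtlas α)) :
    α = β ∧ ∃ ψ ∈ modelIsom, (f.symm.trans f') =ᶠ[𝓝 y] ψ := by
  have hα2 := ne_two_pi_of_mem_Sing hyS
  obtain ⟨ε, hε, hb⟩ := Metric.mem_nhds_iff.1 ((f.symm.trans f').open_source.mem_nhds hy)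
  obtain ⟨hαβ, ψ, hψ, H⟩ := exists_eqOn_modelIsom_of_isLocalHomeomorphOn hα hβ hα2
    Metric.isOpen_ball ⟨⟨y, Metric.mem_ball_self hε⟩, (convex_ball y ε).isPreconnected⟩
    (Metric.mem_ball_self hε) ((mem_Sing_modelAtlas hα hα2).1 hyS)
    ((hf.isAEMorphismOn_transition hA hf').mono Metric.isOpen_ball hb)
    fun z hz => ⟨_, hb hz, rfl⟩
  exact ⟨hαβ, ψ, hψ, mem_of_superset (Metric.ball_mem_nhds y hε) H⟩

lemma eq_of_hasType (hA : IsAEStructure A) {α β : ℝ} (hα : 0 ≤ α) (hβ : 0 ≤ β) {p : M}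
    (hp : p ∈ Sing A) (h : HasType A α p) (h' : HasType A β p) : α = β := by
  obtain ⟨f, hpf, hf⟩ := h
  obtain ⟨f', hpf', hf'⟩ := h'
  refine (hf.transition_eq hA hα hβ hf' (y := f p) ?_ ((hf.mem_Sing_iff hA hα hpf).1 hp)).1
  rw [OpenPartialHomeomorph.trans_source]
  refine ⟨f.map_source hpf, ?_⟩
  rwa [mem_preimage, f.left_inv hpf]

lemma IsModelChart.contDiffOn_transition (hA : IsAEStructure A) {α β : ℝ} (hα : 0 ≤ α)
    (hβ : 0 ≤ β) {f f' : OpenPartialHomeomorph M E3} (hf : IsModelChart A α f)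
    (hf' : IsModelChart A β f') :
    ContDiffOn ℝ ∞ (f.symm.trans f') (f.symm.trans f').source := by
  intro y hy
  apply ContDiffAt.contDiffWithinAt
  by_cases hyS : y ∈ Sing (modelAtlas α)
  · obtain ⟨-, ψ, ⟨t₀, θ₀, rfl⟩, H⟩ := hf.transition_eq hA hα hβ hf' hy hyS
    exact (contDiff_rotTrans t₀ θ₀).contDiffAt.congr_of_eventuallyEq H
  · have hT := hf.isAEMorphismOn_transition hA hf'
    have hα' := isAEStructure_modelAtlas hα
    have hβ' := isAEStructure_modelAtlas hβ
    have hyR : y ∈ Reg (modelAtlas α) := notMem_compl_iff.1 hyS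
    exact (hT.isMorphismAt hα' hβ' (f.symm.trans f').open_source hy hyR
      ((hT.mem_Reg_iff hα' hβ' hy).1 hyR)).contDiffAt hα hβ

/-- Regular charts are charts modelled on `𝔼^{1,2}_{2π}`, that is, on Minkowski space. -/
lemma isModelChart_two_pi {e : OpenPartialHomeomorph M E3} (he : e ∈ regAtlas A) :
    IsModelChart A (2 * Real.pi) e := by
  refine ⟨e.continuousOn, e.source, univ, ⟨e.open_source, fun y hy => ⟨hy, mem_Reg.2 ⟨e, he, hy⟩⟩,
    subset_closure, fun V hV _ hVc => by rwa [inter_eq_left.2 hV]⟩,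
    ⟨isOpen_univ, Reg_two_pi.ge, dense_univ, fun V _ _ hVc => by rwa [inter_univ]⟩,
    fun _ _ => mem_univ _, fun y hy => ⟨e, he, _, refl_mem_regAtlas_two_pi, hy,
      AffineEquiv.refl ℝ E3, refl_mem_minkIsom, Eventually.of_forall fun z => ⟨mem_univ _, rfl⟩⟩⟩

lemma IsSingularFlatManifold.exists_modelChart (h : IsSingularFlatManifold A) (p : M) :
    ∃ f : OpenPartialHomeomorph M E3, p ∈ f.source ∧ ∃ α : ℝ, 0 ≤ α ∧ IsModelChart A α f := by
  by_cases hp : p ∈ Sing A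
  · obtain ⟨α, hα, f, hpf, hf⟩ := h.exists_type p hp
    exact ⟨f, hpf, α, hα, hf⟩
  · obtain ⟨e, he, hpe⟩ := mem_Reg.1 (notMem_compl_iff.1 hp)
    exact ⟨e, hpe, _, by positivity, isModelChart_two_pi he⟩

/-- The charted space structure whose atlas consists of all charts modelled on some
`𝔼^{1,2}_α`, `α ≥ 0`. -/
@[reducible]
noncomputable def IsSingularFlatManifold.chartedSpace (h : IsSingularFlatManifold A) :
    ChartedSpace E3 M where
  atlas := {f | ∃ α : ℝ, 0 ≤ α ∧ IsModelChart A α f}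
  chartAt p := (h.exists_modelChart p).choose
  mem_chart_source p := (h.exists_modelChart p).choose_spec.1
  chart_mem_atlas p := (h.exists_modelChart p).choose_spec.2

lemma IsSingularFlatManifold.isManifold (h : IsSingularFlatManifold A) :
    let _ := h.chartedSpace
    IsManifold (𝓡 3) ∞ M := by
  let _ := h.chartedSpace
  refine isManifold_of_contDiffOn (𝓡 3) ∞ M fun e e' he he' => ?_
  obtain ⟨α, hα, hf⟩ := he
  obtain ⟨β, hβ, hf'⟩ := he'
  simpa using hf.contDiffOn_transition h.aeStructure hα hβ hf'

lemma isClosed_Sing : IsClosed (Sing A) := isOpen_Reg.isClosed_compl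

lemma isClosed_SingOfType (h : IsSingularFlatManifold A) {α : ℝ} (hα : 0 ≤ α) :
    IsClosed (SingOfType A α) := by
  refine isClosed_of_closure_subset fun p hp => ?_
  have hpS : p ∈ Sing A := closure_minimal (fun q hq => hq.1) isClosed_Sing hp
  refine ⟨hpS, ?_⟩
  obtain ⟨β, hβ, f, hpf, hf⟩ := h.exists_type p hpS
  obtain ⟨q, hqf, hqS, hqα⟩ := mem_closure_iff.1 hp f.source f.open_source hpf
  rw [eq_of_hasType h.aeStructure hα hβ hqS hqα ⟨f, hqf, hf⟩]
  exact ⟨f, hpf, hf⟩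

end Types

end FlatSing

theorem mainTheorem10 :
    -- injective morphisms defined on the regular part
    (∀ (α β : ℝ), 0 ≤ α → 0 ≤ β → α ≠ 2 * Real.pi →
      ∀ U : Set FlatSing.E3, IsOpen U → IsConnected U →
        (U ∩ FlatSing.Sing (FlatSing.modelAtlas α)).Nonempty →
      ∀ φ : FlatSing.E3 → FlatSing.E3,
        FlatSing.IsMorphismOn (FlatSing.modelAtlas α) (FlatSing.modelAtlas β) φ
          (U ∩ FlatSing.Reg (FlatSing.modelAtlas α)) →
        Set.InjOn φ (U ∩ FlatSing.Reg (FlatSing.modelAtlas α)) →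
        α = β ∧ ∃ ψ ∈ FlatSing.modelIsom,
          Set.EqOn φ ψ (U ∩ FlatSing.Reg (FlatSing.modelAtlas α))) ∧
    -- almost everywhere morphisms which are local homeomorphisms
    (∀ (α β : ℝ), 0 ≤ α → 0 ≤ β → α ≠ 2 * Real.pi →
      ∀ U : Set FlatSing.E3, IsOpen U → IsConnected U →
        (U ∩ FlatSing.Sing (FlatSing.modelAtlas α)).Nonempty →
      ∀ φ : FlatSing.E3 → FlatSing.E3,
        FlatSing.IsAEMorphismOn (FlatSing.modelAtlas α) (FlatSing.modelAtlas β) φ U →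
        IsLocalHomeomorphOn φ U →
        α = β ∧ ∃ ψ ∈ FlatSing.modelIsom, Set.EqOn φ ψ U) ∧
    -- uniqueness of the type of a singular point
    (∀ (M : Type u) [TopologicalSpace M] (A : Set (OpenPartialHomeomorph M FlatSing.E3)),
      FlatSing.IsSingularFlatManifold A →
      ∀ p ∈ FlatSing.Sing A, ∃! α : ℝ, 0 ≤ α ∧ FlatSing.HasType A α p) ∧
    -- the smooth structure, and the singular locus as a closed submanifold
    (∀ (M : Type u) [TopologicalSpace M] (A : Set (OpenPartialHomeomorph M FlatSing.E3)),
      FlatSing.IsSingularFlatManifold A →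
      ∃ _ : ChartedSpace FlatSing.E3 M, IsManifold (𝓡 3) ∞ M ∧
        (∀ α : ℝ, 0 ≤ α → ∀ f : OpenPartialHomeomorph M FlatSing.E3,
          FlatSing.IsModelChart A α f → f ∈ IsManifold.maximalAtlas (𝓡 3) ∞ M) ∧
        FlatSing.IsClosedOneSubmanifold (FlatSing.Sing A) ∧
        ∀ α : ℝ, 0 ≤ α → FlatSing.IsClosedOneSubmanifold (FlatSing.SingOfType A α)) := by
  refine ⟨?_, ?_, ?_, ?_⟩
  · intro α β hα hβ hα2 U hU hUc ⟨x, hxU, hxS⟩ φ hφ hinj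
    rw [FlatSing.Reg_modelAtlas hα hα2] at hφ hinj ⊢
    exact FlatSing.exists_eqOn_modelIsom hα hβ hα2 hU hUc (hU.mem_nhds hxU) Subset.rfl
      ((FlatSing.mem_Sing_modelAtlas hα hα2).1 hxS) hφ hinj
  · intro α β hα hβ hα2 U hU hUc ⟨x, hxU, hxS⟩ φ hφ hloc
    exact FlatSing.exists_eqOn_modelIsom_of_isLocalHomeomorphOn hα hβ hα2 hU hUc hxU
      ((FlatSing.mem_Sing_modelAtlas hα hα2).1 hxS) hφ hloc
  · intro M _ A h p hp
    obtain ⟨α, hα, hpα⟩ := h.exists_type p hp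
    exact ⟨α, ⟨hα, hpα⟩, fun β hβ =>
      FlatSing.eq_of_hasType h.aeStructure hβ.1 hα hp hβ.2 hpα⟩
  · intro M _ A h
    let _ := h.chartedSpace
    have := h.isManifold
    have hmax : ∀ α : ℝ, 0 ≤ α → ∀ f : OpenPartialHomeomorph M FlatSing.E3,
        FlatSing.IsModelChart A α f → f ∈ IsManifold.maximalAtlas (𝓡 3) ∞ M :=
      fun α hα f hf => IsManifold.subset_maximalAtlas ⟨α, hα, hf⟩
    refine ⟨h.chartedSpace, h.isManifold, hmax, ⟨FlatSing.isClosed_Sing, fun p hp => ?_⟩,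
      fun α hα => ⟨FlatSing.isClosed_SingOfType h hα, fun p hp => ?_⟩⟩
    · obtain ⟨α, hα, f, hpf, hf⟩ := h.exists_type p hp
      exact ⟨f, hmax α hα f hf, hpf, fun q hq => hf.mem_Sing_iff_coord h.aeStructure hα hpf hp hq⟩
    · obtain ⟨hpS, f, hpf, hf⟩ := hp
      refine ⟨f, hmax α hα f hf, hpf, fun q hq => ?_⟩
      rw [← hf.mem_Sing_iff_coord h.aeStructure hα hpf hpS hq]
      exact ⟨fun hq' => hq'.1, fun hq' => ⟨hq', f, hq, hf⟩⟩
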